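/- Let $H, U, U_1, U_2$ be (real or complex) Hilbert spaces and let $A : \mathcal D(A) \subset H \to H$ be a linear operator such that either * $A$ is self-adjoint and positive definite (that is, $\langle Ax, x\rangle > 0$ for all $x \in \mathcal D(A)$, $x \neq 0$) with compact resolvent, or * $H$ is finite-dimensional (and $\mathcal D(A) = H$). Let $B \in \mathscr L(U,H)$, let $\pi : U_1 \times U_2 \to U$ be a linear isomorphism of Hilbert spaces (bounded with bounded inverse), and let $B_1 \in \mathscr L(U_1,H)$, $B_2 \in \mathscr L(U_2,H)$ be the operators with $B\,\pi(u_1,u_2) = B_1 u_1 + B_2 u_2$ for all $(u_1,u_2) \in U_1 \times U_2$. For $f \in L^2(0,T;H)$ and $y_0 \in H$, the solution of $y' + Ay = f$ on $(0,T)$, $y(0) = y_0$, is the function $y \in C([0,T];H)$ with $$\langle z, y(t)\rangle = \langle z, y_0\rangle + \int_0^t \bigl(-\langle A^* z, y(s)\rangle + \langle z, f(s)\rangle\bigr)\,ds \qquad \text{for all } z \in \mathcal D(A^*),\ t \in [0,T]$$ (equivalently, the mild solution given by the semigroup generated by $-A$). Assume that the system $y' + Ay = Bu$, $y(0) = y_0$,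 is null-controllable in arbitrarily small time: for every $T > 0$ there is a constant $C_T$ such that for every $y_0 \in H$ there is $u \in L^2(0,T;U)$ for which the solution satisfies $y(T) = 0$ and $\|u\|_{L^2(0,T;U)} \le C_T \|y_0\|_H$. Then the system $$y' + Ay = B_1 u_1 + B_2 u_2, \qquad t \in (0,T), \qquad y(0) = y_0,$$ is null-controllable in arbitrarily small time with switching controls: for every $T > 0$ there is a constant $C_T'$ such that for every $y_0 \in H$ there are $u_1 \in L^2(0,T;U_1)$ and $u_2 \in L^2(0,T;U_2)$ for which the solution satisfies $y(T) = 0$, and $$\|u_1(t)\|_{U_1}\,\|u_2(t)\|_{U_2} = 0 \quad \text{for a.e. } t \in (0,T), \qquad \|u_1\|_{L^2(0,T;U_1)} + \|u_2\|_{L^2(0,T;U_2)} \le C_T' \|y_0\|_H.$$ -/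

import Mathlib

open MeasureTheory Set

/-- `y` is the solution on `[0, T]` of `y' + A y = f`, `y 0 = y₀`, for a densely defined operator
`A` on `H`: `y` is continuous with values in `H`, and for every `z` in the domain of the adjoint of
`A` the function `t ↦ ⟪z, y t⟫` is the integral of `t ↦ -⟪A† z, y t⟫ + ⟪z, f t⟫` with initial value
`⟪z, y₀⟫`. When `-A` generates a strongly continuous semigroup `S` and `f` is integrable, the only
such `y` is the mild solution `y t = S t y₀ + ∫ s in 0..t, S (t - s) (f s)`. -/
structure IsSolution {𝕜 H : Type*} [RCLike 𝕜] [NormedAddCommGroup H] [InnerProductSpace 𝕜 H]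
    [CompleteSpace H] (A : H →ₗ.[𝕜] H) (f : ℝ → H) (T : ℝ) (y₀ : H) (y : ℝ → H) : Prop where
  continuousOn : ContinuousOn y (Icc 0 T)
  initial : y 0 = y₀
  weak_eq : ∀ z : A.adjoint.domain, ∀ t ∈ Icc 0 T,
    inner 𝕜 (z : H) (y t) = inner 𝕜 (z : H) y₀ +
      ∫ s in (0 : ℝ)..t, (-inner 𝕜 (A.adjoint z) (y s) + inner 𝕜 (z : H) (f s))

/-- The operator `A` has compact resolvent: for some scalar `μ` the operator `μ - A` is a bijection
from the domain of `A` onto `H` whose inverse `R` is a compact (bounded) operator on `H`. -/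
def HasCompactResolvent {𝕜 H : Type*} [RCLike 𝕜] [NormedAddCommGroup H] [InnerProductSpace 𝕜 H]
    (A : H →ₗ.[𝕜] H) : Prop :=
  ∃ (μ : 𝕜) (R : H →L[𝕜] H), IsCompactOperator R ∧
    (∀ x : H, ∃ h : R x ∈ A.domain, μ • R x - A ⟨R x, h⟩ = x) ∧
    (∀ x : A.domain, R (μ • (x : H) - A x) = x)

/-- The operator `A` is positive definite: `⟪A x, x⟫ > 0` for every nonzero `x` in its domain.
(The real part is taken only to have a real number; it is the inner product itself if `A` is
symmetric.) -/
def IsPosDef {𝕜 H : Type*} [RCLike 𝕜] [NormedAddCommGroup H] [InnerProductSpace 𝕜 H]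
    (A : H →ₗ.[𝕜] H) : Prop :=
  ∀ x : A.domain, (x : H) ≠ 0 → 0 < RCLike.re (inner 𝕜 (A x) (x : H))

/-- The system `y' + A y = B u`, `y 0 = y₀` is null-controllable in arbitrarily small times: for
every `T > 0` there is a constant `C` such that every `y₀` is steered to `0` at time `T` by some
control `u ∈ L²(0, T; U)` with `‖u‖_{L²} ≤ C ‖y₀‖`. -/
def NullControllable {𝕜 H U : Type*} [RCLike 𝕜]
    [NormedAddCommGroup H] [InnerProductSpace 𝕜 H] [CompleteSpace H]
    [NormedAddCommGroup U] [InnerProductSpace 𝕜 U]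
    (A : H →ₗ.[𝕜] H) (B : U →L[𝕜] H) : Prop :=
  ∀ T : ℝ, 0 < T → ∃ C : ℝ, ∀ y₀ : H, ∃ u : ℝ → U,
    MemLp u 2 (volume.restrict (Ioo 0 T)) ∧
    (∃ y : ℝ → H, IsSolution A (fun t => B (u t)) T y₀ y ∧ y T = 0) ∧
    (eLpNorm u 2 (volume.restrict (Ioo 0 T))).toReal ≤ C * ‖y₀‖

/-! Run the adjoint semigroup forward in r = T - t. A control steers y₀ to 0 exactly when its time
reversal has L² pairing -⟨S(T)* z, y₀⟩ with the observation r ↦ K* S(r)* z of every z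
(`duality_of_isSolution`, `exists_isSolution_of_duality`). A known null control v₀ may thus be
replaced by any v inducing the same functional on observations, and the aim is to find a switching
one.

Let X be the L²-closure of the observations and minimise ½∫ max(‖p₁‖², ‖p₂‖²) - Re⟨v₀, p⟩ over X. If
at almost every point ‖p₁‖ ≠ ‖p₂‖ or p = 0, the integral is differentiable at p, and its gradient is
p with the smaller component erased. The Euler equation says that this gradient pairs with X as v₀
does (`exists_switching_representative`).

Ties are excluded by multiplying the second component of the observations by √(T + 1 - r). If q = K*
ζ is the unweighted observation of an analytic trajectory ζ and ties persist on a set of positive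
measure, then ‖q₁‖² - (T + 1 - r)‖q₂‖² vanishes for all r > 0. For r > T + 1 this is a sum of
nonnegative terms, so q vanishes there, hence everywhere (`ae_scaleSnd_eq_zero_or_norm_ne`).

The minimiser is only a limit of observations. Null-controllability in every time δ bounds ‖S(δ)* z‖
by the norm of the observation on (0, δ), so the limit is again the observation of a trajectory
analytic on (0, ∞) (`exists_analytic_of_mem_closure`). Analyticity itself comes from the exponential
series in finite dimension, and from an eigenbasis with eigenvalues λ ≥ 0 in the self-adjoint case.
-/

section Minimisation

/-! ### Minimising coercive convex functionals on a Hilbert space -/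

variable {𝕜 F G : Type*} [RCLike 𝕜] [NormedAddCommGroup F] [InnerProductSpace 𝕜 F]
  [NormedAddCommGroup G] [NormedSpace 𝕜 G]

/-- In a Hilbert space, a decreasing sequence of nonempty closed midpoint-convex sets, the first of
which is bounded, has a common point. -/
theorem exists_forall_mem_of_antitone_midpoint [CompleteSpace F] {C : ℕ → Set F}
    (hanti : Antitone C) (hclosed : ∀ n, IsClosed (C n)) (hne : ∀ n, (C n).Nonempty)
    (hmid : ∀ n, ∀ x ∈ C n, ∀ y ∈ C n, (2⁻¹ : 𝕜) • (x + y) ∈ C n)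
    {R : ℝ} (hR : ∀ x ∈ C 0, ‖x‖ ≤ R) : ∃ x, ∀ n, x ∈ C n := by
  set d : ℕ → ℝ := fun n => Metric.infDist 0 (C n) with hd
  have hdle : ∀ n, ∀ x ∈ C n, d n ≤ ‖x‖ := fun n x hx => by
    simpa using Metric.infDist_le_dist_of_mem (x := (0 : F)) hx
  have hmono : Monotone d := fun n m h =>
    Metric.infDist_le_infDist_of_subset (hanti h) (hne m)
  have hdR : ∀ n, d n ≤ R := fun n => by
    obtain ⟨x, hx⟩ := hne n
    exact (hdle n x hx).trans (hR x (hanti (Nat.zero_le n) hx))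
  have hbdd : BddAbove (range d) := ⟨R, by rintro _ ⟨n, rfl⟩; exact hdR n⟩
  set D := ⨆ n, d n
  have hdD : ∀ n, d n ≤ D := fun n => le_ciSup hbdd n
  have hlim : Filter.Tendsto d Filter.atTop (nhds D) := tendsto_atTop_ciSup hmono hbdd
  have hex : ∀ n, ∃ x ∈ C n, ‖x‖ < d n + 1 / ((n : ℝ) + 1) := fun n => by
    obtain ⟨x, hx, h⟩ := (Metric.infDist_lt_iff (x := (0 : F)) (hne n)).1
      (lt_add_of_pos_right (d n) (Nat.one_div_pos_of_nat (n := n)))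
    exact ⟨x, hx, by simpa using h⟩
  choose x hx hxn using hex
  have hd0 : ∀ n, 0 ≤ d n := fun n => Metric.infDist_nonneg
  -- The midpoint of `x n` and `x m` lies in `C N`, so its norm is at least `d N`. The parallelogram
  -- law turns this into a bound on the distance, whose limit is √(4D² - 4D²) = 0.
  have hb : ∀ n m N : ℕ, N ≤ n → N ≤ m →
      dist (x n) (x m) ≤ Real.sqrt (4 * (D + 1 / ((N : ℝ) + 1)) ^ 2 - 4 * d N ^ 2) := by
    intro n m N hn hm
    have key : ∀ k, N ≤ k → ‖x k‖ ≤ D + 1 / ((N : ℝ) + 1) := fun k hk =>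
      (hxn k).le.trans (add_le_add (hdD k) (Nat.one_div_le_one_div hk))
    have h1 := key n hn
    have h2 := key m hm
    have h3 := hdle N _ (hmid N _ (hanti hn (hx n)) _ (hanti hm (hx m)))
    rw [norm_smul, norm_inv, RCLike.norm_ofNat] at h3
    have h4 := parallelogram_law_with_norm 𝕜 (x n) (x m)
    rw [dist_eq_norm]
    apply Real.le_sqrt_of_sq_le
    nlinarith [norm_nonneg (x n), norm_nonneg (x m), hd0 N,
      pow_le_pow_left₀ (norm_nonneg _) h1 2, pow_le_pow_left₀ (norm_nonneg _) h2 2,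
      pow_le_pow_left₀ (hd0 N) h3 2]
  have hlim2 : Filter.Tendsto
      (fun N : ℕ => Real.sqrt (4 * (D + 1 / ((N : ℝ) + 1)) ^ 2 - 4 * d N ^ 2))
      Filter.atTop (nhds 0) := by
    have h := ((((tendsto_one_div_add_atTop_nhds_zero_nat (𝕜 := ℝ)).const_add D).pow 2).const_mul
      4).sub ((hlim.pow 2).const_mul 4)
    have h' := (Real.continuous_sqrt.tendsto _).comp h
    simpa [Function.comp_def] using h'
  obtain ⟨a, ha⟩ := cauchySeq_tendsto_of_complete (cauchySeq_of_le_tendsto_0 _ hb hlim2)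
  refine ⟨a, fun n => (hclosed n).mem_of_tendsto ha ?_⟩
  filter_upwards [Filter.eventually_ge_atTop n] with k hk using hanti hk (hx k)

/-- The sublevel sets just above the infimum are closed, midpoint-convex and bounded by coercivity,
so they have a common point. `G` is merely normed because the application takes L² of a product with
the max norm. -/
theorem exists_forall_half_norm_sq_sub_le [CompleteSpace F] (Φ : F →L[𝕜] G) {K : ℝ} (hK : 0 < K)
    (hΦ : ∀ x, ‖x‖ ≤ K * ‖Φ x‖) (l : F →L[𝕜] 𝕜) :
    ∃ p, ∀ x, ‖Φ p‖ ^ 2 / 2 - RCLike.re (l p) ≤ ‖Φ x‖ ^ 2 / 2 - RCLike.re (l x) := by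
  set J : F → ℝ := fun x => ‖Φ x‖ ^ 2 / 2 - RCLike.re (l x) with hJ
  have hl : ∀ x, RCLike.re (l x) ≤ ‖l‖ * ‖x‖ := fun x =>
    (RCLike.re_le_norm _).trans (l.le_opNorm x)
  have hJc : Continuous J := by fun_prop
  have hbelow : BddBelow (range J) := by
    -- The minimum of s²/2 - ‖l‖ K s over real s, with s = ‖Φ x‖.
    refine ⟨-((‖l‖ * K) ^ 2 / 2), ?_⟩
    rintro _ ⟨x, rfl⟩
    have h1 := hl x
    have h2 := mul_le_mul_of_nonneg_left (hΦ x) (norm_nonneg l)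
    simp only [hJ]
    nlinarith [sq_nonneg (‖Φ x‖ - ‖l‖ * K)]
  set m := sInf (range J)
  have hm : ∀ x, m ≤ J x := fun x => csInf_le hbelow ⟨x, rfl⟩
  have hm0 : m ≤ 0 := by simpa [hJ] using hm 0
  -- Since m ≤ 0, points of the first set satisfy ‖x‖² ≤ 2K²(1 + ‖l‖‖x‖). If ‖x‖ > 1 this gives ‖x‖
  -- ≤ 2K² + 2K²‖l‖; the extra 1 in the radius covers the other case.
  obtain ⟨p, hp⟩ := exists_forall_mem_of_antitone_midpoint (𝕜 := 𝕜) (F := F)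
    (C := fun n : ℕ => {x | J x ≤ m + 1 / ((n : ℝ) + 1)}) (R := 2 * K ^ 2 * ‖l‖ + 2 * K ^ 2 + 1)
    (fun a b hab x hx => le_trans hx
      (add_le_add_right (Nat.one_div_le_one_div hab) m))
    (fun n => isClosed_le hJc continuous_const)
    (fun n => by
      obtain ⟨_, ⟨x, rfl⟩, hx⟩ := exists_lt_of_csInf_lt (range_nonempty J)
        (lt_add_of_pos_right m (Nat.one_div_pos_of_nat (n := n) (α := ℝ)))
      exact ⟨x, hx.le⟩)
    (fun n x hx y hy => by
      simp only [mem_ofPred_eq, hJ] at hx hy ⊢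
      have h1 : ‖Φ ((2⁻¹ : 𝕜) • (x + y))‖ ≤ (‖Φ x‖ + ‖Φ y‖) / 2 := by
        rw [map_smul, map_add, norm_smul, norm_inv, RCLike.norm_ofNat]
        linarith [norm_add_le (Φ x) (Φ y)]
      have h2 : RCLike.re (l ((2⁻¹ : 𝕜) • (x + y))) =
          (RCLike.re (l x) + RCLike.re (l y)) / 2 := by
        have : (2⁻¹ : 𝕜) = ((2⁻¹ : ℝ) : 𝕜) := by
          rw [RCLike.ofReal_inv, RCLike.ofReal_ofNat]
        rw [map_smul, map_add, this, smul_eq_mul, RCLike.re_ofReal_mul, map_add]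
        ring
      rw [h2]
      nlinarith [pow_le_pow_left₀ (norm_nonneg _) h1 2, sq_nonneg (‖Φ x‖ - ‖Φ y‖)])
    (fun x hx => by
      simp only [mem_ofPred_eq, hJ, Nat.cast_zero, zero_add, div_one] at hx
      by_contra! hcon
      have h1 := hl x
      have h2 : ‖x‖ ^ 2 ≤ K ^ 2 * ‖Φ x‖ ^ 2 := by
        rw [← mul_pow]; exact pow_le_pow_left₀ (norm_nonneg _) (hΦ x) 2
      have h3 : ‖Φ x‖ ^ 2 ≤ 2 * (1 + ‖l‖ * ‖x‖) := by linarith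
      have h4 : ‖x‖ ^ 2 ≤ K ^ 2 * (2 * (1 + ‖l‖ * ‖x‖)) :=
        h2.trans (mul_le_mul_of_nonneg_left h3 (by positivity))
      have h6 : 0 ≤ 2 * K ^ 2 * ‖l‖ := by positivity
      have h7 : 0 < 2 * K ^ 2 := by positivity
      have h5 : 1 < ‖x‖ := by linarith
      nlinarith)
  refine ⟨p, fun x => le_trans (le_of_forall_pos_lt_add fun ε hε => ?_) (hm x)⟩
  obtain ⟨n, hn⟩ := exists_nat_one_div_lt hε
  exact (hp n).trans_lt (by linarith)

end Minimisation

/-! ### The max-norm energy, its gradient and the switching representative -/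

section Switching

theorem Lp_two_norm_sq {α G : Type*} [MeasurableSpace α] {μ : Measure α} [NormedAddCommGroup G]
    (f : Lp G 2 μ) : ‖f‖ ^ 2 = ∫ x, ‖f x‖ ^ 2 ∂μ := by
  have h0 : 0 ≤ ∫ x, ‖f x‖ ^ 2 ∂μ := integral_nonneg fun x => by positivity
  rw [Lp.norm_def, (Lp.memLp f).eLpNorm_eq_integral_rpow_norm (by norm_num) (by norm_num)]
  have h2 : (2 : ENNReal).toReal = ((2 : ℕ) : ℝ) := by norm_num
  simp only [h2, Real.rpow_natCast]
  rw [ENNReal.toReal_ofReal (by positivity), ← Real.rpow_natCast, ← Real.rpow_mul h0]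
  norm_num

variable {𝕜 U₁ U₂ : Type*} [RCLike 𝕜]
  [NormedAddCommGroup U₁] [InnerProductSpace 𝕜 U₁]
  [NormedAddCommGroup U₂] [InnerProductSpace 𝕜 U₂]

/-- The dominant component of a pair: the component of larger norm is kept, the other one is
replaced by zero. -/
noncomputable def dominantPart (v : WithLp 2 (U₁ × U₂)) : WithLp 2 (U₁ × U₂) :=
  {v | ‖v.snd‖ < ‖v.fst‖}.indicator (fun v => WithLp.toLp 2 (v.fst, 0)) v +
  {v | ‖v.fst‖ < ‖v.snd‖}.indicator (fun v => WithLp.toLp 2 (0, v.snd)) v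

theorem dominantPart_of_snd_lt {v : WithLp 2 (U₁ × U₂)} (h : ‖v.snd‖ < ‖v.fst‖) :
    dominantPart v = WithLp.toLp 2 (v.fst, 0) := by
  simp [dominantPart, h, h.le]

theorem dominantPart_of_fst_lt {v : WithLp 2 (U₁ × U₂)} (h : ‖v.fst‖ < ‖v.snd‖) :
    dominantPart v = WithLp.toLp 2 (0, v.snd) := by
  simp [dominantPart, h, h.le]

theorem dominantPart_of_eq {v : WithLp 2 (U₁ × U₂)} (h : ‖v.fst‖ = ‖v.snd‖) :
    dominantPart v = 0 := by
  simp [dominantPart, h]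

/-- Ties are sent to zero, so no separation assumption is needed here; separation matters only for
differentiating the maximum. -/
theorem dominantPart_fst_eq_zero_or (v : WithLp 2 (U₁ × U₂)) :
    (dominantPart v).fst = 0 ∨ (dominantPart v).snd = 0 := by
  rcases lt_trichotomy ‖v.fst‖ ‖v.snd‖ with h | h | h
  · simp [dominantPart_of_fst_lt h]
  · simp [dominantPart_of_eq h]
  · simp [dominantPart_of_snd_lt h]

theorem norm_dominantPart_le (v : WithLp 2 (U₁ × U₂)) : ‖dominantPart v‖ ≤ ‖v‖ := by
  rw [← sq_le_sq₀ (norm_nonneg _) (norm_nonneg _), WithLp.prod_norm_sq_eq_of_L2,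
    WithLp.prod_norm_sq_eq_of_L2]
  rcases lt_trichotomy ‖v.fst‖ ‖v.snd‖ with h | h | h
  · simp [dominantPart_of_fst_lt h]
  · simp [dominantPart_of_eq h]; positivity
  · simp [dominantPart_of_snd_lt h]

theorem stronglyMeasurable_dominantPart_comp {α : Type*} [MeasurableSpace α]
    {f : α → WithLp 2 (U₁ × U₂)} (hf : StronglyMeasurable f) :
    StronglyMeasurable fun x => dominantPart (f x) := by
  have h1 : StronglyMeasurable fun x => (f x).fst :=
    (WithLp.continuous_fst 2 U₁ U₂).comp_stronglyMeasurable hf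
  have h2 : StronglyMeasurable fun x => (f x).snd :=
    (WithLp.continuous_snd 2 U₁ U₂).comp_stronglyMeasurable hf
  have hc : Continuous (WithLp.toLp 2 : U₁ × U₂ → WithLp 2 (U₁ × U₂)) :=
    WithLp.prod_continuous_toLp 2 U₁ U₂
  exact ((hc.comp_stronglyMeasurable (h1.prodMk stronglyMeasurable_const)).indicator
    (measurableSet_lt h2.norm.measurable h1.norm.measurable)).add
    ((hc.comp_stronglyMeasurable (stronglyMeasurable_const.prodMk h2)).indicator
    (measurableSet_lt h1.norm.measurable h2.norm.measurable))

theorem norm_add_ofReal_smul_sq {E : Type*} [NormedAddCommGroup E] [InnerProductSpace 𝕜 E]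
    (x y : E) (t : ℝ) :
    ‖x + (t : 𝕜) • y‖ ^ 2 = ‖x‖ ^ 2 + 2 * t * RCLike.re (inner 𝕜 x y) + t ^ 2 * ‖y‖ ^ 2 := by
  rw [norm_add_sq (𝕜 := 𝕜), inner_smul_right, RCLike.re_ofReal_mul, norm_smul, mul_pow,
    RCLike.norm_ofReal, sq_abs]
  ring

theorem hasDerivAt_norm_add_ofReal_smul_sq {E : Type*} [NormedAddCommGroup E]
    [InnerProductSpace 𝕜 E] (x y : E) :
    HasDerivAt (fun t : ℝ => ‖x + (t : 𝕜) • y‖ ^ 2) (2 * RCLike.re (inner 𝕜 x y)) 0 := by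
  simp only [norm_add_ofReal_smul_sq]
  have h := (((hasDerivAt_id (0 : ℝ)).const_mul 2).mul_const (RCLike.re (inner 𝕜 x y))
    |>.const_add (‖x‖ ^ 2)).add (((hasDerivAt_id (0 : ℝ)).pow 2).mul_const (‖y‖ ^ 2))
  exact HasDerivAt.congr_deriv h (by simp)

theorem ofLp_norm_eq_max (v : WithLp 2 (U₁ × U₂)) : ‖WithLp.ofLp v‖ = max ‖v.fst‖ ‖v.snd‖ := rfl

/-- `WithLp.ofLp` passes from the Hilbert norm to the max norm. Away from a tie the maximum is
attained by one fixed component for t near 0, and only that component is differentiated. At p = 0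
the function is a multiple of t². A nonzero tie could produce a kink. -/
theorem hasDerivAt_norm_ofLp_sq {p q : WithLp 2 (U₁ × U₂)}
    (hp : p = 0 ∨ ‖p.fst‖ ≠ ‖p.snd‖) :
    HasDerivAt (fun t : ℝ => ‖WithLp.ofLp (p + (t : 𝕜) • q)‖ ^ 2)
      (2 * RCLike.re (inner 𝕜 (dominantPart p) q)) 0 := by
  have hc1 : Continuous fun t : ℝ => ‖p.fst + (t : 𝕜) • q.fst‖ := by fun_prop
  have hc2 : Continuous fun t : ℝ => ‖p.snd + (t : 𝕜) • q.snd‖ := by fun_prop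
  rcases hp with rfl | hp
  · rw [dominantPart_of_eq (by simp)]
    have h := ((hasDerivAt_id (0 : ℝ)).pow 2).mul_const (‖WithLp.ofLp q‖ ^ 2)
    refine (HasDerivAt.congr_deriv h (by simp)).congr_of_eventuallyEq (.of_forall fun t => ?_)
    simp only [zero_add]
    rw [WithLp.ofLp_smul, norm_smul, RCLike.norm_ofReal, mul_pow, sq_abs]
    rfl
  · rcases lt_or_gt_of_ne hp with h | h
    · rw [dominantPart_of_fst_lt h, WithLp.prod_inner_apply]
      have hd := hasDerivAt_norm_add_ofReal_smul_sq (𝕜 := 𝕜) p.snd q.snd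
      refine (HasDerivAt.congr_deriv hd (by simp)).congr_of_eventuallyEq ?_
      have := (hc1.continuousAt (x := 0)).eventually_lt hc2.continuousAt (by simpa using h)
      filter_upwards [this] with t ht
      rw [ofLp_norm_eq_max, WithLp.add_fst, WithLp.add_snd, WithLp.smul_fst, WithLp.smul_snd,
        max_eq_right ht.le]
    · rw [dominantPart_of_snd_lt h, WithLp.prod_inner_apply]
      have hd := hasDerivAt_norm_add_ofReal_smul_sq (𝕜 := 𝕜) p.fst q.fst
      refine (HasDerivAt.congr_deriv hd (by simp)).congr_of_eventuallyEq ?_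
      have := (hc2.continuousAt (x := 0)).eventually_lt hc1.continuousAt (by simpa using h)
      filter_upwards [this] with t ht
      rw [ofLp_norm_eq_max, WithLp.add_fst, WithLp.add_snd, WithLp.smul_fst, WithLp.smul_snd,
        max_eq_left ht.le]

theorem norm_ofLp_le (v : WithLp 2 (U₁ × U₂)) : ‖WithLp.ofLp v‖ ≤ ‖v‖ := by
  rw [← sq_le_sq₀ (norm_nonneg _) (norm_nonneg _), WithLp.prod_norm_sq_eq_of_L2,
    ofLp_norm_eq_max]
  rcases max_choice ‖v.fst‖ ‖v.snd‖ with h | h <;> rw [h] <;>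
    nlinarith [sq_nonneg ‖v.fst‖, sq_nonneg ‖v.snd‖]

theorem norm_le_two_mul_norm_ofLp (v : WithLp 2 (U₁ × U₂)) : ‖v‖ ≤ 2 * ‖WithLp.ofLp v‖ := by
  rw [← sq_le_sq₀ (norm_nonneg _) (by positivity), WithLp.prod_norm_sq_eq_of_L2,
    ofLp_norm_eq_max]
  have h1 := pow_le_pow_left₀ (norm_nonneg _) (le_max_left ‖v.fst‖ ‖v.snd‖) 2
  have h2 := pow_le_pow_left₀ (norm_nonneg _) (le_max_right ‖v.fst‖ ‖v.snd‖) 2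
  nlinarith

/-- Factor the difference of squares; for |t| ≤ 1 both norms are at most ‖p‖ + ‖q‖. For p, q in L²
the constant is integrable, which permits differentiation under the integral. -/
theorem lipschitzOnWith_norm_ofLp_sq (p q : WithLp 2 (U₁ × U₂)) :
    LipschitzOnWith (Real.nnabs (2 * (‖p‖ + ‖q‖) * ‖q‖))
      (fun t : ℝ => ‖WithLp.ofLp (p + (t : 𝕜) • q)‖ ^ 2) (Metric.ball 0 1) := by
  refine LipschitzOnWith.of_dist_le_mul fun s hs t ht => ?_
  have hb : ∀ s ∈ Metric.ball (0 : ℝ) 1, ‖WithLp.ofLp (p + (s : 𝕜) • q)‖ ≤ ‖p‖ + ‖q‖ := by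
    intro s hs
    refine (norm_ofLp_le _).trans ((norm_add_le _ _).trans ?_)
    rw [norm_smul, RCLike.norm_ofReal]
    have : |s| ≤ 1 := by simpa using (mem_ball_zero_iff.1 hs).le
    nlinarith [norm_nonneg q]
  have hd : |‖WithLp.ofLp (p + (s : 𝕜) • q)‖ - ‖WithLp.ofLp (p + (t : 𝕜) • q)‖| ≤
      |s - t| * ‖q‖ := by
    refine (abs_norm_sub_norm_le _ _).trans ?_
    rw [← WithLp.ofLp_sub]
    refine (norm_ofLp_le _).trans ?_
    rw [add_sub_add_left_eq_sub, ← sub_smul, ← RCLike.ofReal_sub, norm_smul, RCLike.norm_ofReal]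
  have h0 : 0 ≤ 2 * (‖p‖ + ‖q‖) * ‖q‖ := by positivity
  rw [Real.dist_eq, Real.dist_eq, Real.coe_nnabs, abs_of_nonneg h0, sq_sub_sq, abs_mul]
  have h1 : |‖WithLp.ofLp (p + (s : 𝕜) • q)‖ + ‖WithLp.ofLp (p + (t : 𝕜) • q)‖| ≤
      2 * (‖p‖ + ‖q‖) := by
    rw [abs_of_nonneg (by positivity)]
    linarith [hb s hs, hb t ht]
  calc _ ≤ (2 * (‖p‖ + ‖q‖)) * (|s - t| * ‖q‖) :=
        mul_le_mul h1 hd (abs_nonneg _) (by positivity)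
    _ = 2 * (‖p‖ + ‖q‖) * ‖q‖ * |s - t| := by ring

variable {α : Type*} [MeasurableSpace α] {μ : Measure α}

theorem hasDerivAt_integral_norm_ofLp_sq (p q : Lp (WithLp 2 (U₁ × U₂)) 2 μ)
    (hp : ∀ᵐ x ∂μ, p x = 0 ∨ ‖(p x).fst‖ ≠ ‖(p x).snd‖) :
    HasDerivAt (fun t : ℝ => ∫ x, ‖WithLp.ofLp (p x + (t : 𝕜) • q x)‖ ^ 2 ∂μ)
      (∫ x, 2 * RCLike.re (inner 𝕜 (dominantPart (p x)) (q x)) ∂μ) 0 := by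
  have hpm := Lp.stronglyMeasurable p
  have hqm := Lp.stronglyMeasurable q
  have hc : Continuous (WithLp.ofLp : WithLp 2 (U₁ × U₂) → U₁ × U₂) :=
    WithLp.prod_continuous_ofLp 2 U₁ U₂
  have hm : ∀ t : ℝ, StronglyMeasurable fun x => ‖WithLp.ofLp (p x + (t : 𝕜) • q x)‖ ^ 2 :=
    fun t => (hc.norm.pow 2).comp_stronglyMeasurable (hpm.add (hqm.const_smul (t : 𝕜)))
  have hpi : Integrable (fun x => ‖p x‖ ^ 2) μ := (Lp.memLp p).norm.integrable_sq
  have hqi : Integrable (fun x => ‖q x‖ ^ 2) μ := (Lp.memLp q).norm.integrable_sq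
  have hpq : Integrable (fun x => ‖p x‖ * ‖q x‖) μ :=
    (Lp.memLp p).norm.integrable_mul (Lp.memLp q).norm
  refine (hasDerivAt_integral_of_dominated_loc_of_lip (μ := μ)
    (F := fun (t : ℝ) x => ‖WithLp.ofLp (p x + (t : 𝕜) • q x)‖ ^ 2)
    (F' := fun x => 2 * RCLike.re (inner 𝕜 (dominantPart (p x)) (q x)))
    (bound := fun x => 2 * (‖p x‖ + ‖q x‖) * ‖q x‖) (Metric.ball_mem_nhds 0 one_pos)
    (.of_forall fun t => (hm t).aestronglyMeasurable) ?_ ?_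
    (.of_forall fun x => lipschitzOnWith_norm_ofLp_sq (p x) (q x)) ?_ ?_).2
  · refine hpi.mono' (hm 0).aestronglyMeasurable (.of_forall fun x => ?_)
    rw [RCLike.ofReal_zero, zero_smul, add_zero, Real.norm_of_nonneg (by positivity)]
    exact pow_le_pow_left₀ (norm_nonneg _) (norm_ofLp_le _) 2
  · exact ((RCLike.continuous_re.comp_stronglyMeasurable
      ((stronglyMeasurable_dominantPart_comp hpm).inner hqm)).const_mul 2).aestronglyMeasurable
  · refine ((hpq.const_mul 2).add (hqi.const_mul 2)).congr (.of_forall fun x => ?_)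
    simp only [Pi.add_apply]; ring
  · filter_upwards [hp] with x hx using hasDerivAt_norm_ofLp_sq hx

/-- Let `X` be a closed subspace of `L²(μ; U₁ × U₂)` whose elements `p = (p₁, p₂)` satisfy
`‖p₁‖ ≠ ‖p₂‖` or `p = 0` at almost every point. Then the functional on `X` represented by
`v₀` is also represented by some `v` with one component vanishing at every point. -/
theorem exists_switching_representative [CompleteSpace U₁] [CompleteSpace U₂]
    (X : Submodule 𝕜 (Lp (WithLp 2 (U₁ × U₂)) 2 μ))
    (hX : IsClosed (X : Set (Lp (WithLp 2 (U₁ × U₂)) 2 μ)))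
    (hsep : ∀ p ∈ X, ∀ᵐ x ∂μ, p x = 0 ∨ ‖(p x).fst‖ ≠ ‖(p x).snd‖)
    (v₀ : Lp (WithLp 2 (U₁ × U₂)) 2 μ) :
    ∃ v : Lp (WithLp 2 (U₁ × U₂)) 2 μ, (∀ q ∈ X, inner 𝕜 q v = inner 𝕜 q v₀) ∧
      (∀ᵐ x ∂μ, (v x).fst = 0 ∨ (v x).snd = 0) ∧ ‖v‖ ≤ 8 * ‖v₀‖ := by
  have : CompleteSpace X := hX.completeSpace_coe
  -- The pointwise identity, with the Euclidean product norm on the source and the max norm on the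
  -- target; `‖Ψ f‖ ^ 2` is the energy to be minimised.
  set Ψ : Lp (WithLp 2 (U₁ × U₂)) 2 μ →L[𝕜] Lp (U₁ × U₂) 2 μ :=
    (WithLp.prodContinuousLinearEquiv 2 𝕜 U₁ U₂ : WithLp 2 (U₁ × U₂) →L[𝕜] U₁ × U₂).compLpL 2 μ
  have hΨ : ∀ f : Lp (WithLp 2 (U₁ × U₂)) 2 μ, (Ψ f : α → U₁ × U₂) =ᵐ[μ]
      fun x => WithLp.ofLp (f x) := fun f => ContinuousLinearMap.coeFn_compLpL _ f
  have hΨsq : ∀ f, ‖Ψ f‖ ^ 2 = ∫ x, ‖WithLp.ofLp (f x)‖ ^ 2 ∂μ := fun f => by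
    rw [Lp_two_norm_sq]
    exact integral_congr_ae ((hΨ f).mono fun x hx => by simp only [hx])
  have hΨle : ∀ f, ‖f‖ ≤ 2 * ‖Ψ f‖ := fun f => Lp.norm_le_mul_norm_of_ae_le_mul <| by
    filter_upwards [hΨ f] with x hx
    rw [hx]
    exact norm_le_two_mul_norm_ofLp _
  obtain ⟨p, hp⟩ := exists_forall_half_norm_sq_sub_le (Ψ.comp X.subtypeL) two_pos
    (fun f => hΨle f) ((innerSL 𝕜 v₀).comp X.subtypeL)
  simp only [ContinuousLinearMap.comp_apply, Submodule.subtypeL_apply, innerSL_apply_apply] at hp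
  set P : Lp (WithLp 2 (U₁ × U₂)) 2 μ := (p : Lp (WithLp 2 (U₁ × U₂)) 2 μ)
  have hPm := hsep P p.2
  have hvmem : MemLp (fun x => dominantPart (P x)) 2 μ :=
    (Lp.memLp P).of_le
      (stronglyMeasurable_dominantPart_comp (Lp.stronglyMeasurable P)).aestronglyMeasurable
      (.of_forall fun x => norm_dominantPart_le _)
  have hvcoe := hvmem.coeFn_toLp
  -- Euler equation: the functional restricted to the real line P + t q has a minimum at t = 0.
  have hreal : ∀ q ∈ X, RCLike.re (inner 𝕜 (hvmem.toLp _) q) = RCLike.re (inner 𝕜 v₀ q) := by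
    intro q hq
    have hJ : ∀ t : ℝ, ‖Ψ (P + (t : 𝕜) • q)‖ ^ 2 / 2 - RCLike.re (inner 𝕜 v₀ (P + (t : 𝕜) • q)) =
        (∫ x, ‖WithLp.ofLp (P x + (t : 𝕜) • q x)‖ ^ 2 ∂μ) / 2 -
          (RCLike.re (inner 𝕜 v₀ P) + t * RCLike.re (inner 𝕜 v₀ q)) := by
      intro t
      rw [hΨsq, inner_add_right, inner_smul_right, map_add, RCLike.re_ofReal_mul]
      congr 2
      refine integral_congr_ae ?_
      filter_upwards [Lp.coeFn_add P ((t : 𝕜) • q), Lp.coeFn_smul (t : 𝕜) q] with x h1 h2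
      simp only [h1, h2, Pi.add_apply, Pi.smul_apply]
    have hd := ((hasDerivAt_integral_norm_ofLp_sq (𝕜 := 𝕜) P q hPm).div_const 2).sub
      (((hasDerivAt_id (0 : ℝ)).mul_const (RCLike.re (inner 𝕜 v₀ q))).const_add
        (RCLike.re (inner 𝕜 v₀ P)))
    have hmin : IsLocalMin (fun t : ℝ => (∫ x, ‖WithLp.ofLp (P x + (t : 𝕜) • q x)‖ ^ 2 ∂μ) / 2 -
        (RCLike.re (inner 𝕜 v₀ P) + t * RCLike.re (inner 𝕜 v₀ q))) 0 := by
      refine .of_forall fun t => ?_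
      simp only
      rw [← hJ, ← hJ]
      simpa using hp (p + (t : 𝕜) • ⟨q, hq⟩)
    have h0 := hmin.hasDerivAt_eq_zero hd
    rw [L2.inner_def]
    have hint : Integrable (fun x => inner 𝕜 ((hvmem.toLp _) x) (q x)) μ :=
      L2.integrable_inner _ _
    have hre : RCLike.re (∫ x, inner 𝕜 ((hvmem.toLp _) x) (q x) ∂μ) =
        ∫ x, RCLike.re (inner 𝕜 (dominantPart (P x)) (q x)) ∂μ := by
      rw [← integral_re hint]
      exact integral_congr_ae (hvcoe.mono fun x hx => by simp only [hx])
    rw [integral_const_mul] at h0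
    rw [hre]
    linarith
  refine ⟨hvmem.toLp _, fun q hq => ?_, ?_, ?_⟩
  · rw [← inner_conj_symm, ← inner_conj_symm q v₀]
    congr 1
    apply RCLike.ext (hreal q hq)
    -- Testing with I • q recovers the imaginary part; over the reals both sides are zero.
    have h := hreal ((RCLike.I : 𝕜) • q) (X.smul_mem _ hq)
    rw [inner_smul_right, inner_smul_right, RCLike.I_mul_re, RCLike.I_mul_re] at h
    linarith
  · filter_upwards [hvcoe] with x hx
    rw [hx]
    exact dominantPart_fst_eq_zero_or _
  -- Comparison with the zero competitor gives ‖Ψ P‖² ≤ 2‖v₀‖‖P‖; with ‖P‖ ≤ 2‖Ψ P‖ the constant is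
  -- 4 · 2 = 8.
  · have h0 := hp 0
    simp only [ZeroMemClass.coe_zero, map_zero, inner_zero_right, norm_zero] at h0
    have h1 : RCLike.re (inner 𝕜 v₀ P) ≤ ‖v₀‖ * ‖P‖ := re_inner_le_norm _ _
    have h2 := hΨle P
    have h3 : ‖hvmem.toLp _‖ ≤ ‖P‖ := Lp.norm_le_norm_of_ae_le <| by
      filter_upwards [hvcoe] with x hx
      rw [hx]
      exact norm_dominantPart_le _
    have h4 : ‖P‖ * ‖P‖ ≤ 8 * ‖v₀‖ * ‖P‖ := by
      nlinarith [norm_nonneg P, pow_le_pow_left₀ (norm_nonneg _) h2 2]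
    rcases (norm_nonneg P).eq_or_lt with h5 | h5
    · rw [← h5] at h3
      exact h3.trans (by positivity)
    · exact h3.trans (le_of_mul_le_mul_right h4 h5)

end Switching

/-! ### Mild solutions, weak solutions and time reversal -/

section Semigroup

variable {𝕜 H : Type*} [RCLike 𝕜] [NormedAddCommGroup H] [InnerProductSpace 𝕜 H]
  [CompleteSpace H]

/-- `S t`, `t ≥ 0`, is a strongly continuous semigroup generated by `-A`, expressed through the
properties used for null-controllability: its orbits are weak solutions of `y' + A y = 0`, weak
solutions are unique, and the orbits of the adjoint semigroup are analytic for positive times. -/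
structure IsAnalyticSemigroup [NormedSpace ℝ H] (A : H →ₗ.[𝕜] H) (S : ℝ → H →L[𝕜] H) : Prop where
  continuous : Continuous fun p : ℝ × H => S p.1 p.2
  zero : S 0 = 1
  add : ∀ s t : ℝ, 0 ≤ s → 0 ≤ t → S (s + t) = (S s).comp (S t)
  bound : ∀ T : ℝ, ∃ M : ℝ, ∀ t ∈ Icc 0 T, ‖S t‖ ≤ M
  weak_eq : ∀ z : A.adjoint.domain, ∀ t : ℝ, 0 ≤ t → ∀ x : H,
    inner 𝕜 (z : H) (S t x) = inner 𝕜 (z : H) x - ∫ s in (0 : ℝ)..t, inner 𝕜 (A.adjoint z) (S s x)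
  unique : ∀ (T : ℝ) (d : ℝ → H), ContinuousOn d (Icc 0 T) →
    (∀ z : A.adjoint.domain, ∀ t ∈ Icc 0 T,
      inner 𝕜 (z : H) (d t) = -∫ s in (0 : ℝ)..t, inner 𝕜 (A.adjoint z) (d s)) →
    ∀ t ∈ Icc 0 T, d t = 0
  analytic : ∀ z : H, AnalyticOnNhd ℝ (fun t => ContinuousLinearMap.adjoint (S t) z) (Ioi 0)

/-- The mild solution of `y' + A y = f`, `y 0 = y₀`. -/
noncomputable def mildSolution [NormedSpace ℝ H] (S : ℝ → H →L[𝕜] H) (f : ℝ → H) (y₀ : H) (t : ℝ) :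
    H :=
  S t y₀ + ∫ s in (0 : ℝ)..t, S (t - s) (f s)

namespace IsAnalyticSemigroup

variable [NormedSpace ℝ H] {A : H →ₗ.[𝕜] H} {S : ℝ → H →L[𝕜] H}

theorem continuous_apply (hS : IsAnalyticSemigroup A S) (x : H) : Continuous fun t => S t x :=
  hS.continuous.comp (continuous_id.prodMk continuous_const)

theorem aestronglyMeasurable_convolution (hS : IsAnalyticSemigroup A S) {f : ℝ → H}
    {μ : Measure ℝ} (hf : AEStronglyMeasurable f μ) (t : ℝ) :
    AEStronglyMeasurable (fun s => S (t - s) (f s)) μ :=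
  hS.continuous.comp_aestronglyMeasurable
    ((continuous_const.sub continuous_id).aestronglyMeasurable.prodMk hf)

theorem intervalIntegrable_convolution (hS : IsAnalyticSemigroup A S) {f : ℝ → H} {T : ℝ}
    (hf : IntegrableOn f (Ioc 0 T)) {t : ℝ} (ht : t ∈ Icc 0 T) :
    IntervalIntegrable (fun s => S (t - s) (f s)) volume 0 t := by
  obtain ⟨M, hM⟩ := hS.bound T
  have hft : IntegrableOn f (Ioc 0 t) := hf.mono_set (Ioc_subset_Ioc_right ht.2)
  rw [intervalIntegrable_iff_integrableOn_Ioc_of_le ht.1]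
  refine (hft.norm.const_mul M).mono' (hS.aestronglyMeasurable_convolution hft.1 t) ?_
  filter_upwards [ae_restrict_mem measurableSet_Ioc] with s hs
  exact (S (t - s)).le_of_opNorm_le (hM _ ⟨by linarith [hs.2], by linarith [hs.1, ht.2]⟩) _

theorem continuousOn_mildSolution (hS : IsAnalyticSemigroup A S) {f : ℝ → H} {T : ℝ}
    (hf : IntegrableOn f (Ioc 0 T)) (y₀ : H) : ContinuousOn (mildSolution S f y₀) (Icc 0 T) := by
  refine (hS.continuous_apply y₀).continuousOn.add ?_
  obtain ⟨M, hM⟩ := hS.bound T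
  -- Moving the variable endpoint into an indicator allows dominated convergence over a fixed
  -- interval; for fixed s the integrand can jump at t₀ only if s = t₀, a null set.
  have heq : EqOn (fun t => ∫ s in (0 : ℝ)..t, S (t - s) (f s))
      (fun t => ∫ s in Ioc 0 T, (Iic t).indicator (fun s => S (t - s) (f s)) s) (Icc 0 T) := by
    intro t ht
    simp only
    rw [intervalIntegral.integral_of_le ht.1, setIntegral_indicator measurableSet_Iic,
      Ioc_inter_Iic, min_eq_right ht.2]
  refine ContinuousOn.congr ?_ heq
  intro t₀ ht₀
  refine continuousWithinAt_of_dominated (bound := fun s => M * ‖f s‖) (.of_forall fun t =>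
    (hS.aestronglyMeasurable_convolution hf.1 t).indicator measurableSet_Iic) ?_
    (hf.norm.const_mul M) ?_
  · filter_upwards [self_mem_nhdsWithin] with t ht
    filter_upwards [ae_restrict_mem measurableSet_Ioc] with s hs
    by_cases h : s ≤ t
    · rw [indicator_of_mem (by exact h)]
      exact (S (t - s)).le_of_opNorm_le (hM _ ⟨by linarith, by linarith [hs.1, ht.2]⟩) _
    · rw [indicator_of_notMem (by exact h), norm_zero]
      exact mul_nonneg ((norm_nonneg _).trans (hM t₀ ht₀)) (norm_nonneg _)
  · have hne : ∀ᵐ s ∂(volume.restrict (Ioc 0 T)), s ≠ t₀ := by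
      refine ae_restrict_of_ae ?_
      simp [ae_iff]
    filter_upwards [hne] with s hs
    apply ContinuousAt.continuousWithinAt
    have hc : Continuous fun t => S (t - s) (f s) :=
      (hS.continuous_apply (f s)).comp (continuous_id.sub continuous_const)
    rcases lt_or_gt_of_ne hs with h | h
    · refine hc.continuousAt.congr ?_
      filter_upwards [lt_mem_nhds h] with t ht
      rw [indicator_of_mem (by exact ht.le)]
    · refine (continuousAt_const (y := (0 : H))).congr ?_
      filter_upwards [gt_mem_nhds h] with t ht
      rw [indicator_of_notMem (by simpa using ht)]

theorem integral_integral_convolution_swap (hS : IsAnalyticSemigroup A S) {f : ℝ → H} {t : ℝ}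
    (ht : 0 ≤ t) (hf : IntegrableOn f (Ioc 0 t)) (w : H) :
    ∫ s in (0 : ℝ)..t, ∫ r in s..t, inner 𝕜 w (S (r - s) (f s)) =
      ∫ r in (0 : ℝ)..t, ∫ s in (0 : ℝ)..r, inner 𝕜 w (S (r - s) (f s)) := by
  obtain ⟨M, hM⟩ := hS.bound t
  set k : ℝ → ℝ → 𝕜 := fun s r =>
    {p : ℝ × ℝ | p.1 ≤ p.2}.indicator (fun p => inner 𝕜 w (S (p.2 - p.1) (f p.1))) (s, r) with hk
  have hk1 : ∀ s r, s ≤ r → k s r = inner 𝕜 w (S (r - s) (f s)) := fun s r h =>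
    indicator_of_mem (s := {p : ℝ × ℝ | p.1 ≤ p.2})
      (f := fun p : ℝ × ℝ => inner 𝕜 w (S (p.2 - p.1) (f p.1))) (a := (s, r)) h
  have hk0 : ∀ s r, ¬ s ≤ r → k s r = 0 := fun s r h =>
    indicator_of_notMem (s := {p : ℝ × ℝ | p.1 ≤ p.2})
      (f := fun p : ℝ × ℝ => inner 𝕜 w (S (p.2 - p.1) (f p.1))) (a := (s, r)) h
  have hmeas : AEStronglyMeasurable
      (fun p : ℝ × ℝ => inner 𝕜 w (S (p.2 - p.1) (f p.1)))
      ((volume.restrict (Ioc 0 t)).prod (volume.restrict (Ioc 0 t))) :=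
    ((innerSL 𝕜 w).continuous.comp hS.continuous).comp_aestronglyMeasurable
      ((continuous_snd.sub continuous_fst).aestronglyMeasurable.prodMk hf.1.comp_fst)
  have hint : Integrable (Function.uncurry k)
      ((volume.restrict (Ioc 0 t)).prod (volume.restrict (Ioc 0 t))) := by
    refine ((hf.norm.comp_fst (volume.restrict (Ioc 0 t))).const_mul (‖w‖ * M)).mono'
      (hmeas.indicator (measurableSet_le measurable_fst measurable_snd)) ?_
    rw [Measure.prod_restrict]
    filter_upwards [ae_restrict_mem (measurableSet_Ioc.prod measurableSet_Ioc)] with p hp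
    have hM0 : 0 ≤ M := (norm_nonneg _).trans (hM 0 ⟨le_rfl, ht⟩)
    by_cases h : p.1 ≤ p.2
    · have : Function.uncurry k p = inner 𝕜 w (S (p.2 - p.1) (f p.1)) :=
        hk1 _ _ h
      rw [this, mul_assoc]
      exact (norm_inner_le_norm _ _).trans (mul_le_mul_of_nonneg_left
        ((S (p.2 - p.1)).le_of_opNorm_le (hM _ ⟨by linarith, by linarith [hp.1.1, hp.2.2]⟩) _)
        (norm_nonneg _))
    · have : Function.uncurry k p = 0 :=
        hk0 _ _ h
      rw [this, norm_zero]
      positivity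
  have h1 : ∫ s in (0 : ℝ)..t, ∫ r in s..t, inner 𝕜 w (S (r - s) (f s)) =
      ∫ s in Ioc 0 t, ∫ r in Ioc 0 t, k s r := by
    rw [intervalIntegral.integral_of_le ht]
    refine setIntegral_congr_fun measurableSet_Ioc fun s hs => ?_
    rw [intervalIntegral.integral_of_le hs.2, ← integral_Icc_eq_integral_Ioc]
    have : k s = (Ici s).indicator fun r => inner 𝕜 w (S (r - s) (f s)) := by
      ext r; by_cases h : s ≤ r <;> simp [hk1, hk0, h]
    rw [this, setIntegral_indicator measurableSet_Ici]
    congr 2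
    ext r
    simp only [mem_inter_iff, mem_Icc, mem_Ioc, mem_Ici]
    exact ⟨fun h => ⟨⟨hs.1.trans_le h.1, h.2⟩, h.1⟩, fun h => ⟨h.2, h.1.2⟩⟩
  have h2 : ∫ r in (0 : ℝ)..t, ∫ s in (0 : ℝ)..r, inner 𝕜 w (S (r - s) (f s)) =
      ∫ r in Ioc 0 t, ∫ s in Ioc 0 t, k s r := by
    rw [intervalIntegral.integral_of_le ht]
    refine setIntegral_congr_fun measurableSet_Ioc fun r hr => ?_
    rw [intervalIntegral.integral_of_le hr.1.le]
    have : (fun s => k s r) = (Iic r).indicator fun s => inner 𝕜 w (S (r - s) (f s)) := by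
      ext s; by_cases h : s ≤ r <;> simp [hk1, hk0, h]
    rw [this, setIntegral_indicator measurableSet_Iic, Ioc_inter_Iic, min_eq_right hr.2]
  rw [h1, h2]
  exact integral_integral_swap hint

theorem inner_mildSolution (hS : IsAnalyticSemigroup A S) {f : ℝ → H} {T : ℝ}
    (hf : IntegrableOn f (Ioc 0 T)) (y₀ : H) {t : ℝ} (ht : t ∈ Icc 0 T) (w : H) :
    inner 𝕜 w (mildSolution S f y₀ t) =
      inner 𝕜 w (S t y₀) + ∫ s in (0 : ℝ)..t, inner 𝕜 w (S (t - s) (f s)) := by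
  rw [mildSolution, inner_add_right]
  congr 1
  exact ((innerSL 𝕜 w).intervalIntegral_comp_comm
    (hS.intervalIntegrable_convolution hf ht)).symm

/-- Apply the weak identity of the semigroup to the orbit of `f s` over time t - s, integrate in s,
and exchange the integrals over the triangle s ≤ r ≤ t. -/
theorem isSolution_mildSolution (hS : IsAnalyticSemigroup A S) {f : ℝ → H} {T : ℝ}
    (hf : IntegrableOn f (Ioc 0 T)) (y₀ : H) : IsSolution A f T y₀ (mildSolution S f y₀) := by
  refine ⟨hS.continuousOn_mildSolution hf y₀, by simp [mildSolution, hS.zero], fun z t ht => ?_⟩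
  have hft : IntegrableOn f (Ioc 0 t) := hf.mono_set (Ioc_subset_Ioc_right ht.2)
  have hzf : IntervalIntegrable (fun s => inner 𝕜 (z : H) (f s)) volume 0 t :=
    (intervalIntegrable_iff_integrableOn_Ioc_of_le ht.1).2 (hft.const_inner (z : H))
  have hSy : Continuous fun s => inner 𝕜 (A.adjoint z) (S s y₀) :=
    continuous_const.inner (hS.continuous_apply y₀)
  have hy : IntervalIntegrable (fun s => inner 𝕜 (A.adjoint z) (mildSolution S f y₀ s))
      volume 0 t := by
    apply ContinuousOn.intervalIntegrable_of_Icc ht.1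
    exact continuousOn_const.inner
      ((hS.continuousOn_mildSolution hf y₀).mono (Icc_subset_Icc_right ht.2))
  have hconv : EqOn (fun s => ∫ r in (0 : ℝ)..s, inner 𝕜 (A.adjoint z) (S (s - r) (f r)))
      (fun s => inner 𝕜 (A.adjoint z) (mildSolution S f y₀ s) -
        inner 𝕜 (A.adjoint z) (S s y₀)) (uIcc 0 t) := by
    intro s hs
    rw [uIcc_of_le ht.1] at hs
    simp only
    rw [hS.inner_mildSolution hf y₀ ⟨hs.1, hs.2.trans ht.2⟩, add_sub_cancel_left]
  have hinner : EqOn (fun s => inner 𝕜 (z : H) (f s) - inner 𝕜 (z : H) (S (t - s) (f s)))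
      (fun s => ∫ r in s..t, inner 𝕜 (A.adjoint z) (S (r - s) (f s))) (uIcc 0 t) := by
    intro s hs
    rw [uIcc_of_le ht.1] at hs
    simp only
    rw [hS.weak_eq z (t - s) (by linarith [hs.2]), sub_sub_cancel]
    rw [intervalIntegral.integral_comp_sub_right
      (fun r => inner 𝕜 (A.adjoint z) (S r (f s))), sub_self]
  have hzS : IntervalIntegrable (fun s => inner 𝕜 (z : H) (S (t - s) (f s))) volume 0 t := by
    have h := hS.intervalIntegrable_convolution hf ht
    rw [intervalIntegrable_iff_integrableOn_Ioc_of_le ht.1] at h ⊢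
    exact h.const_inner (z : H)
  have hsw := hS.integral_integral_convolution_swap ht.1 hft (A.adjoint z)
  rw [intervalIntegral.integral_congr hconv, ← intervalIntegral.integral_congr hinner,
    intervalIntegral.integral_sub hzf hzS,
    intervalIntegral.integral_sub hy (hSy.intervalIntegrable _ _)] at hsw
  rw [hS.inner_mildSolution hf y₀ ht, hS.weak_eq z t ht.1,
    intervalIntegral.integral_add (f := fun s => -inner 𝕜 (A.adjoint z) (mildSolution S f y₀ s))
      hy.neg hzf, intervalIntegral.integral_neg]
  linear_combination -hsw

theorem eqOn_mildSolution (hS : IsAnalyticSemigroup A S) {f : ℝ → H} {T : ℝ}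
    (hf : IntegrableOn f (Ioc 0 T)) {y₀ : H} {y : ℝ → H} (hy : IsSolution A f T y₀ y) :
    EqOn y (mildSolution S f y₀) (Icc 0 T) := by
  have hm := hS.isSolution_mildSolution hf y₀
  intro t ht
  refine sub_eq_zero.1 (hS.unique T (fun t => y t - mildSolution S f y₀ t)
    (hy.continuousOn.sub hm.continuousOn) (fun z t ht => ?_) t ht)
  have hft : IntegrableOn f (Ioc 0 t) := hf.mono_set (Ioc_subset_Ioc_right ht.2)
  have hzf : IntervalIntegrable (fun s => inner 𝕜 (z : H) (f s)) volume 0 t :=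
    (intervalIntegrable_iff_integrableOn_Ioc_of_le ht.1).2 (hft.const_inner (z : H))
  have hc : ∀ y : ℝ → H, ContinuousOn y (Icc 0 T) →
      IntervalIntegrable (fun s => inner 𝕜 (A.adjoint z) (y s)) volume 0 t := fun y hy =>
    ContinuousOn.intervalIntegrable_of_Icc ht.1
      (continuousOn_const.inner (hy.mono (Icc_subset_Icc_right ht.2)))
  have h1 := hc _ hy.continuousOn
  have h2 := hc _ hm.continuousOn
  simp only [inner_sub_right]
  rw [hy.weak_eq z t ht, hm.weak_eq z t ht,
    intervalIntegral.integral_add (f := fun s => -inner 𝕜 (A.adjoint z) (y s)) h1.neg hzf,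
    intervalIntegral.integral_add (f := fun s => -inner 𝕜 (A.adjoint z) (mildSolution S f y₀ s))
      h2.neg hzf, intervalIntegral.integral_sub h1 h2,
    intervalIntegral.integral_neg, intervalIntegral.integral_neg]
  ring

/-- The substitution r = T - s makes the adjoint semigroup run forward, with its possible loss of
analyticity at r = 0. -/
theorem inner_mildSolution_eq_adjoint (hS : IsAnalyticSemigroup A S) {f : ℝ → H} {T : ℝ}
    (hT : 0 ≤ T) (hf : IntegrableOn f (Ioc 0 T)) (y₀ z : H) :
    inner 𝕜 z (mildSolution S f y₀ T) = inner 𝕜 (ContinuousLinearMap.adjoint (S T) z) y₀ +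
      ∫ r in Ioo 0 T, inner 𝕜 (ContinuousLinearMap.adjoint (S r) z) (f (T - r)) := by
  rw [hS.inner_mildSolution hf y₀ ⟨hT, le_rfl⟩, ContinuousLinearMap.adjoint_inner_left]
  congr 1
  rw [← integral_Ioc_eq_integral_Ioo, ← intervalIntegral.integral_of_le hT]
  simp only [ContinuousLinearMap.adjoint_inner_left]
  have h := intervalIntegral.integral_comp_sub_left (a := 0) (b := T)
    (fun s => inner 𝕜 z (S (T - s) (f s))) T
  simpa using h.symm

end IsAnalyticSemigroup

theorem measurePreserving_const_sub_Ioo (T : ℝ) :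
    MeasurePreserving (fun s : ℝ => T - s) (volume.restrict (Ioo 0 T))
      (volume.restrict (Ioo 0 T)) := by
  have h := (Measure.measurePreserving_sub_left volume T).restrict_preimage
    (measurableSet_Ioo (a := (0 : ℝ)) (b := T))
  simpa using h

theorem memLp_comp_const_sub {E : Type*} [NormedAddCommGroup E] {u : ℝ → E} {T : ℝ} {p : ENNReal}
    (hu : MemLp u p (volume.restrict (Ioo 0 T))) :
    MemLp (fun s => u (T - s)) p (volume.restrict (Ioo 0 T)) ∧
      eLpNorm (fun s => u (T - s)) p (volume.restrict (Ioo 0 T)) =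
        eLpNorm u p (volume.restrict (Ioo 0 T)) :=
  have hmp := measurePreserving_const_sub_Ioo T
  ⟨hu.comp_measurePreserving hmp, eLpNorm_comp_measurePreserving hu.1 hmp⟩

end Semigroup

/-! ### Weights on the second component -/

section ScaleSnd

variable {𝕜 U₁ U₂ : Type*} [RCLike 𝕜]
  [NormedAddCommGroup U₁] [NormedAddCommGroup U₂] [InnerProductSpace 𝕜 U₂]

variable (𝕜) in
/-- Multiplication of the second component of a pair by a real number. -/
noncomputable def scaleSnd (b : ℝ) (v : WithLp 2 (U₁ × U₂)) : WithLp 2 (U₁ × U₂) :=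
  WithLp.toLp 2 (v.fst, (b : 𝕜) • v.snd)

theorem continuous_scaleSnd :
    Continuous fun p : ℝ × WithLp 2 (U₁ × U₂) => scaleSnd 𝕜 p.1 p.2 := by
  have h1 : Continuous fun v : WithLp 2 (U₁ × U₂) => v.fst := WithLp.continuous_fst 2 U₁ U₂
  have h2 : Continuous fun v : WithLp 2 (U₁ × U₂) => v.snd := WithLp.continuous_snd 2 U₁ U₂
  exact (WithLp.prod_continuous_toLp 2 U₁ U₂).comp ((h1.comp continuous_snd).prodMk
    ((RCLike.continuous_ofReal.comp continuous_fst).smul (h2.comp continuous_snd)))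

theorem scaleSnd_add (b : ℝ) (v w : WithLp 2 (U₁ × U₂)) :
    scaleSnd 𝕜 b (v + w) = scaleSnd 𝕜 b v + scaleSnd 𝕜 b w := by
  simp [scaleSnd, ← WithLp.toLp_add]

theorem scaleSnd_smul [InnerProductSpace 𝕜 U₁] (b : ℝ) (c : 𝕜) (v : WithLp 2 (U₁ × U₂)) :
    scaleSnd 𝕜 b (c • v) = c • scaleSnd 𝕜 b v := by
  simp [scaleSnd, ← WithLp.toLp_smul, smul_comm c (b : 𝕜)]

theorem scaleSnd_scaleSnd_inv {b : ℝ} (hb : b ≠ 0) (v : WithLp 2 (U₁ × U₂)) :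
    scaleSnd 𝕜 b (scaleSnd 𝕜 b⁻¹ v) = v := by
  have : (b : 𝕜) ≠ 0 := by exact_mod_cast hb
  simp only [scaleSnd, WithLp.toLp_fst, WithLp.toLp_snd, RCLike.ofReal_inv, smul_smul,
    mul_inv_cancel₀ this, one_smul]
  rfl

theorem inner_scaleSnd_left [InnerProductSpace 𝕜 U₁] (b : ℝ) (v w : WithLp 2 (U₁ × U₂)) :
    inner 𝕜 (scaleSnd 𝕜 b v) w = inner 𝕜 v (scaleSnd 𝕜 b w) := by
  simp [scaleSnd, WithLp.prod_inner_apply, inner_smul_left, inner_smul_right]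

theorem norm_scaleSnd_le_of_le {b c : ℝ} (hb : 0 ≤ b) (h1 : 1 ≤ c) (hbc : b ≤ c)
    (v : WithLp 2 (U₁ × U₂)) : ‖scaleSnd 𝕜 b v‖ ≤ c * ‖v‖ := by
  have hc : 0 ≤ c := by linarith
  rw [← sq_le_sq₀ (norm_nonneg _) (by positivity), mul_pow, WithLp.prod_norm_sq_eq_of_L2,
    WithLp.prod_norm_sq_eq_of_L2]
  simp only [scaleSnd, WithLp.toLp_fst, WithLp.toLp_snd, norm_smul, RCLike.norm_ofReal, mul_pow,
    sq_abs]
  have h3 : b ^ 2 ≤ c ^ 2 := pow_le_pow_left₀ hb hbc 2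
  have h4 : 1 ≤ c ^ 2 := one_le_pow₀ h1
  nlinarith [sq_nonneg ‖v.fst‖, sq_nonneg ‖v.snd‖]

theorem norm_le_norm_scaleSnd {b : ℝ} (hb : 1 ≤ b) (v : WithLp 2 (U₁ × U₂)) :
    ‖v‖ ≤ ‖scaleSnd 𝕜 b v‖ := by
  rw [← sq_le_sq₀ (norm_nonneg _) (norm_nonneg _), WithLp.prod_norm_sq_eq_of_L2,
    WithLp.prod_norm_sq_eq_of_L2]
  simp only [scaleSnd, WithLp.toLp_fst, WithLp.toLp_snd, norm_smul, RCLike.norm_ofReal, mul_pow,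
    sq_abs]
  have h4 : 1 ≤ b ^ 2 := one_le_pow₀ hb
  nlinarith [sq_nonneg ‖v.snd‖]

theorem MeasureTheory.MemLp.scaleSnd {T : ℝ} {f : ℝ → WithLp 2 (U₁ × U₂)} {b : ℝ → ℝ} {c : ℝ}
    (hf : MemLp f 2 (volume.restrict (Ioo 0 T))) (hb : Measurable b) (hc : 1 ≤ c)
    (hbc : ∀ r ∈ Ioo 0 T, 0 ≤ b r ∧ b r ≤ c) :
    MemLp (fun r => scaleSnd 𝕜 (b r) (f r)) 2 (volume.restrict (Ioo 0 T)) := by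
  refine hf.of_le_mul (c := c) (continuous_scaleSnd.comp_aestronglyMeasurable
    (hb.aestronglyMeasurable.prodMk hf.1)) ?_
  filter_upwards [ae_restrict_mem measurableSet_Ioo] with r hr
  exact norm_scaleSnd_le_of_le (hbc r hr).1 hc (hbc r hr).2 _

end ScaleSnd

/-! ### Real-analytic trajectories and the exclusion of ties -/

section Analytic

variable {𝕜 H E : Type*} [RCLike 𝕜] [NormedAddCommGroup H] [InnerProductSpace 𝕜 H]
  [NormedSpace ℝ H] [IsScalarTower ℝ 𝕜 H]
  [NormedAddCommGroup E] [InnerProductSpace 𝕜 E]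

/-- The squared norm is analytic only over ℝ, so even for complex scalars `E` is given its real
inner product. -/
theorem analyticOnNhd_norm_sq_clm_comp {s : Set ℝ} {ζ : ℝ → H} (hζ : AnalyticOnNhd ℝ ζ s)
    (L : H →L[𝕜] E) : AnalyticOnNhd ℝ (fun r => ‖L (ζ r)‖ ^ 2) s := by
  let _ : InnerProductSpace ℝ E := InnerProductSpace.rclikeToReal 𝕜 E
  have : IsScalarTower ℝ 𝕜 E := ⟨fun r c x => by
    rw [RCLike.real_smul_eq_coe_mul, mul_smul]; rfl⟩
  intro r hr
  have h1 : AnalyticAt ℝ (fun r => L (ζ r)) r :=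
    ((L.restrictScalars ℝ).analyticAt _).comp (hζ r hr)
  have h2 : AnalyticAt ℝ (fun x : E => ‖x‖ ^ 2) (L (ζ r)) :=
    (contDiff_norm_sq ℝ).contDiffAt.analyticAt
  exact AnalyticAt.fun_comp (g := fun x : E => ‖x‖ ^ 2) (f := fun r => L (ζ r)) h2 h1

/-- Zeros of a nontrivial analytic function on a connected set are isolated, hence Lebesgue-null. -/
theorem AnalyticOnNhd.eqOn_zero_or_ae_ne_zero {h : ℝ → ℝ} {U : Set ℝ} (hh : AnalyticOnNhd ℝ h U)
    (hU : IsConnected U) (hUm : MeasurableSet U) :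
    EqOn h 0 U ∨ ∀ᵐ r ∂(volume.restrict U), h r ≠ 0 := by
  by_contra! hcon
  obtain ⟨h1, h2⟩ := hcon
  simp only [EqOn, not_forall] at h1
  obtain ⟨x, hxU, hx⟩ := h1
  have h3 := hh.preimage_zero_mem_codiscreteWithin hx hxU hU
  exact h2 (ae_restrict_le_codiscreteWithin hUm h3)

variable {U₁ U₂ : Type*} [NormedAddCommGroup U₁] [InnerProductSpace 𝕜 U₁]
  [NormedAddCommGroup U₂] [InnerProductSpace 𝕜 U₂]

/-- The weight `√(a - r)` separates the norms of the components of an analytic trajectory: these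
can only agree on a set of positive measure if the trajectory vanishes, since `a - r` changes sign
on `(0, ∞)`. -/
theorem ae_scaleSnd_eq_zero_or_norm_ne {ζ : ℝ → H} (hζ : AnalyticOnNhd ℝ ζ (Ioi 0))
    (L : H →L[𝕜] WithLp 2 (U₁ × U₂)) {a T : ℝ} (ha : 0 < a) (haT : T ≤ a) :
    ∀ᵐ r ∂(volume.restrict (Ioo 0 T)), scaleSnd 𝕜 (√(a - r)) (L (ζ r)) = 0 ∨
      ‖(scaleSnd 𝕜 (√(a - r)) (L (ζ r))).fst‖ ≠ ‖(scaleSnd 𝕜 (√(a - r)) (L (ζ r))).snd‖ := by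
  have h1 : AnalyticOnNhd ℝ (fun r => ‖(L (ζ r)).fst‖ ^ 2) (Ioi 0) :=
    analyticOnNhd_norm_sq_clm_comp hζ ((WithLp.fstL 2 𝕜 U₁ U₂).comp L)
  have h2 : AnalyticOnNhd ℝ (fun r => ‖(L (ζ r)).snd‖ ^ 2) (Ioi 0) :=
    analyticOnNhd_norm_sq_clm_comp hζ ((WithLp.sndL 2 𝕜 U₁ U₂).comp L)
  have h3 : AnalyticOnNhd ℝ (fun r => ‖(L (ζ r)).fst‖ ^ 2 - (a - r) * ‖(L (ζ r)).snd‖ ^ 2)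
      (Ioi 0) :=
    h1.sub ((analyticOnNhd_const.sub analyticOnNhd_id).mul h2)
  rcases h3.eqOn_zero_or_ae_ne_zero ⟨nonempty_Ioi, isPreconnected_Ioi⟩ measurableSet_Ioi with h | h
  -- Beyond a the identity reads ‖·‖² + (r - a)‖·‖² = 0, so both terms vanish. The identity theorem
  -- then carries the vanishing from a neighbourhood of a + 1 back to (0, ∞).
  · have hfar : ∀ r, a < r → ‖(L (ζ r)).fst‖ ^ 2 = 0 ∧ ‖(L (ζ r)).snd‖ ^ 2 = 0 := by
      intro r hr
      have := h (show r ∈ Ioi 0 from ha.trans hr)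
      simp only [Pi.zero_apply] at this
      have h5 := sq_nonneg ‖(L (ζ r)).fst‖
      have h6 := sq_nonneg ‖(L (ζ r)).snd‖
      have h7 : ‖(L (ζ r)).fst‖ ^ 2 = 0 := by nlinarith
      refine ⟨h7, ?_⟩
      rw [h7, zero_sub, neg_eq_zero, mul_eq_zero] at this
      exact this.resolve_left (by linarith)
    have hev : ∀ᶠ r in nhds (a + 1), a < r := lt_mem_nhds (by linarith)
    have hz1 := h1.eqOn_zero_of_preconnected_of_eventuallyEq_zero isPreconnected_Ioi
      (show a + 1 ∈ Ioi 0 by simp; linarith) (hev.mono fun r hr => (hfar r hr).1)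
    have hz2 := h2.eqOn_zero_of_preconnected_of_eventuallyEq_zero isPreconnected_Ioi
      (show a + 1 ∈ Ioi 0 by simp; linarith) (hev.mono fun r hr => (hfar r hr).2)
    filter_upwards [ae_restrict_mem measurableSet_Ioo] with r hr
    left
    have e1 : (L (ζ r)).fst = 0 := by simpa using hz1 hr.1
    have e2 : (L (ζ r)).snd = 0 := by simpa using hz2 hr.1
    rw [scaleSnd, e1, e2, smul_zero]
    rfl
  · have h' := ae_restrict_of_ae_restrict_of_subset
      (fun r hr => hr.1 : Ioo 0 T ⊆ Ioi 0) h
    filter_upwards [h', ae_restrict_mem measurableSet_Ioo] with r hr hrT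
    right
    intro heq
    apply hr
    simp only [scaleSnd, WithLp.toLp_fst, WithLp.toLp_snd, norm_smul, RCLike.norm_ofReal] at heq
    rw [heq, mul_pow, sq_abs, Real.sq_sqrt (by linarith [hrT.2]), sub_self]

end Analytic

theorem MeasureTheory.MemLp.integrableOn_Ioc_clm_comp {𝕜 E H : Type*} [RCLike 𝕜]
    [NormedAddCommGroup E] [NormedSpace 𝕜 E] [NormedAddCommGroup H] [NormedSpace 𝕜 H] {u : ℝ → E} {T : ℝ} (hu : MemLp u 2 (volume.restrict (Ioo 0 T)))
    (K : E →L[𝕜] H) : IntegrableOn (fun t => K (u t)) (Ioc 0 T) := by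
  rw [integrableOn_Ioc_iff_integrableOn_Ioo]
  exact (K.comp_memLp' hu).integrable (by norm_num)

/-! ### Duality between control and observation -/

section Control

variable {𝕜 H : Type*} [RCLike 𝕜] [NormedAddCommGroup H] [InnerProductSpace 𝕜 H]
  [CompleteSpace H] [NormedSpace ℝ H]
  {E : Type*} [NormedAddCommGroup E] [InnerProductSpace 𝕜 E] [CompleteSpace E]

namespace IsAnalyticSemigroup

variable {A : H →ₗ.[𝕜] H} {S : ℝ → H →L[𝕜] H}

theorem duality_of_isSolution (hS : IsAnalyticSemigroup A S) (K : E →L[𝕜] H) {T : ℝ} (hT : 0 ≤ T)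
    {u : ℝ → E} (hu : MemLp u 2 (volume.restrict (Ioo 0 T))) {y₀ : H} {y : ℝ → H}
    (hy : IsSolution A (fun t => K (u t)) T y₀ y) (hyT : y T = 0) (z : H) :
    ∫ r in Ioo 0 T, inner 𝕜 (K.adjoint ((S r).adjoint z)) (u (T - r)) =
      -inner 𝕜 ((S T).adjoint z) y₀ := by
  have h := hS.inner_mildSolution_eq_adjoint hT (hu.integrableOn_Ioc_clm_comp K) y₀ z
  rw [← hS.eqOn_mildSolution (hu.integrableOn_Ioc_clm_comp K) hy ⟨hT, le_rfl⟩, hyT,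
    inner_zero_right] at h
  simp only [ContinuousLinearMap.adjoint_inner_left] at h ⊢
  linear_combination -h

theorem exists_isSolution_of_duality (hS : IsAnalyticSemigroup A S) (K : E →L[𝕜] H) {T : ℝ}
    (hT : 0 ≤ T) {w : ℝ → E} (hw : MemLp w 2 (volume.restrict (Ioo 0 T))) {y₀ : H}
    (h : ∀ z, ∫ r in Ioo 0 T, inner 𝕜 (K.adjoint ((S r).adjoint z)) (w r) =
      -inner 𝕜 ((S T).adjoint z) y₀) :
    ∃ y, IsSolution A (fun t => K (w (T - t))) T y₀ y ∧ y T = 0 := by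
  have hf := (memLp_comp_const_sub hw).1.integrableOn_Ioc_clm_comp K
  refine ⟨_, hS.isSolution_mildSolution hf y₀, ?_⟩
  refine ext_inner_left 𝕜 fun z => ?_
  have h1 := h z
  simp only [ContinuousLinearMap.adjoint_inner_left] at h1
  rw [hS.inner_mildSolution_eq_adjoint hT hf, inner_zero_right]
  simp only [ContinuousLinearMap.adjoint_inner_left, sub_sub_cancel]
  rw [h1, add_neg_cancel]

theorem adjoint_add_apply (hS : IsAnalyticSemigroup A S) {s t : ℝ} (hs : 0 ≤ s) (ht : 0 ≤ t)
    (z : H) : (S (s + t)).adjoint z = (S s).adjoint ((S t).adjoint z) := by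
  rw [add_comm, hS.add t s ht hs, ContinuousLinearMap.adjoint_comp]
  rfl

theorem memLp_observation (hS : IsAnalyticSemigroup A S) (K : E →L[𝕜] H) (T : ℝ) (z : H) :
    MemLp (fun r => K.adjoint ((S r).adjoint z)) 2 (volume.restrict (Ioo 0 T)) := by
  obtain ⟨M, hM⟩ := hS.bound T
  have hc : ContinuousOn (fun r => (S r).adjoint z) (Ioo 0 T) :=
    (hS.analytic z).continuousOn.mono Ioo_subset_Ioi_self
  refine MemLp.of_bound (C := ‖K.adjoint‖ * (M * ‖z‖))
    ((K.adjoint.continuous.comp_continuousOn hc).aestronglyMeasurable measurableSet_Ioo) ?_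
  filter_upwards [ae_restrict_mem measurableSet_Ioo] with r hr
  refine K.adjoint.le_opNorm_of_le ((S r).adjoint.le_of_opNorm_le ?_ z)
  rw [LinearIsometryEquiv.norm_map]
  exact hM r ⟨hr.1.le, hr.2.le⟩

/-- Control the initial datum S(T)* z itself: the duality identity tested with the same z gives
-‖S(T)* z‖² as the pairing of observation and control. Cauchy-Schwarz and the cost bound conclude.
The absolute value is taken because the cost constant has no prescribed sign. -/
theorem observability (hS : IsAnalyticSemigroup A S) (K : E →L[𝕜] H) (hnull : NullControllable A K)
    {T : ℝ} (hT : 0 < T) : ∃ C : ℝ, 0 ≤ C ∧ ∀ z : H, ‖(S T).adjoint z‖ ≤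
      C * (eLpNorm (fun r => K.adjoint ((S r).adjoint z)) 2
        (volume.restrict (Ioo 0 T))).toReal := by
  obtain ⟨C, hC⟩ := hnull T hT
  refine ⟨|C|, abs_nonneg C, fun z => ?_⟩
  obtain ⟨u, hu, ⟨y, hy, hyT⟩, hun⟩ := hC ((S T).adjoint z)
  have hdual := hS.duality_of_isSolution K hT.le hu hy hyT z
  have hO := hS.memLp_observation K T z
  obtain ⟨hv, hvn⟩ := memLp_comp_const_sub hu
  have hin : inner 𝕜 (hO.toLp _) (hv.toLp _) = -inner 𝕜 ((S T).adjoint z) ((S T).adjoint z) := by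
    rw [← hdual, L2.inner_def]
    refine integral_congr_ae ?_
    filter_upwards [hO.coeFn_toLp, hv.coeFn_toLp] with r h1 h2
    rw [h1, h2]
  have hle := norm_inner_le_norm (𝕜 := 𝕜) (hO.toLp _) (hv.toLp _)
  rw [hin, norm_neg, inner_self_eq_norm_sq_to_K, norm_pow, RCLike.norm_ofReal, abs_norm,
    Lp.norm_toLp, Lp.norm_toLp, hvn] at hle
  set N := ‖(S T).adjoint z‖
  set O := (eLpNorm (fun r => K.adjoint ((S r).adjoint z)) 2 (volume.restrict (Ioo 0 T))).toReal
  have hO0 : 0 ≤ O := ENNReal.toReal_nonneg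
  have hN0 : 0 ≤ N := norm_nonneg _
  have h2 : N ^ 2 ≤ O * (|C| * N) :=
    hle.trans (mul_le_mul_of_nonneg_left (hun.trans (by gcongr; exact le_abs_self C)) hO0)
  rcases hN0.eq_or_lt with h0 | h0
  · rw [← h0]; positivity
  · nlinarith

end IsAnalyticSemigroup

end Control

/-! ### Limits of observations and the switching control -/

section Control

variable {𝕜 H : Type*} [RCLike 𝕜] [NormedAddCommGroup H] [InnerProductSpace 𝕜 H]
  [CompleteSpace H] [NormedSpace ℝ H]
  {U₁ U₂ : Type*} [NormedAddCommGroup U₁] [InnerProductSpace 𝕜 U₁] [CompleteSpace U₁]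
  [NormedAddCommGroup U₂] [InnerProductSpace 𝕜 U₂] [CompleteSpace U₂]

/-- The weight changes sign at T + 1 rather than at T so that on (0, T) it stays at least 1:
weighting then does not decrease norms, and dividing by the weight does not increase them. -/
theorem one_le_sqrt_weight {T r : ℝ} (hr : r ∈ Ioo 0 T) : 1 ≤ √(T + 1 - r) :=
  Real.one_le_sqrt.2 (by linarith [hr.2])

theorem sqrt_weight_le {T r : ℝ} (hr : r ∈ Ioo 0 T) : √(T + 1 - r) ≤ T + 1 := by
  have h0 : 0 < T := hr.1.trans hr.2
  rw [Real.sqrt_le_left (by linarith)]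
  nlinarith [hr.1]

namespace IsAnalyticSemigroup

variable {A : H →ₗ.[𝕜] H} {S : ℝ → H →L[𝕜] H}

theorem memLp_weightedObservation (hS : IsAnalyticSemigroup A S)
    (K : WithLp 2 (U₁ × U₂) →L[𝕜] H) {T : ℝ} (hT : 0 < T) (z : H) :
    MemLp (fun r => scaleSnd 𝕜 (√(T + 1 - r)) (K.adjoint ((S r).adjoint z))) 2
      (volume.restrict (Ioo 0 T)) :=
  (hS.memLp_observation K T z).scaleSnd (by fun_prop) (by linarith : 1 ≤ T + 1)
    fun _ hr => ⟨Real.sqrt_nonneg _, sqrt_weight_le hr⟩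

/-- The observation of the adjoint trajectory issued from `z`, in reversed time and with a weight
on the second component. -/
noncomputable def weightedObservation (hS : IsAnalyticSemigroup A S)
    (K : WithLp 2 (U₁ × U₂) →L[𝕜] H) {T : ℝ} (hT : 0 < T) :
    H →ₗ[𝕜] Lp (WithLp 2 (U₁ × U₂)) 2 (volume.restrict (Ioo 0 T)) where
  toFun z := (hS.memLp_weightedObservation K hT z).toLp _
  map_add' z w := by
    rw [← MemLp.toLp_add]
    congr 1
    ext1 r
    simp only [map_add, scaleSnd_add, Pi.add_apply]
  map_smul' c z := by
    rw [RingHom.id_apply, ← MemLp.toLp_const_smul]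
    congr 1
    ext1 r
    simp only [map_smul, scaleSnd_smul, Pi.smul_apply]

theorem coeFn_weightedObservation (hS : IsAnalyticSemigroup A S)
    (K : WithLp 2 (U₁ × U₂) →L[𝕜] H) {T : ℝ} (hT : 0 < T) (z : H) :
    (hS.weightedObservation K hT z : ℝ → WithLp 2 (U₁ × U₂)) =ᵐ[volume.restrict (Ioo 0 T)]
      fun r => scaleSnd 𝕜 (√(T + 1 - r)) (K.adjoint ((S r).adjoint z)) :=
  (hS.memLp_weightedObservation K hT z).coeFn_toLp

/-- Observability is used on (0, δ) and then enlarged to (0, T). This is where control in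
arbitrarily small time enters: z is recovered after any delay δ. -/
theorem exists_norm_adjoint_le_weightedObservation (hS : IsAnalyticSemigroup A S)
    (K : WithLp 2 (U₁ × U₂) →L[𝕜] H) (hnull : NullControllable A K) {T : ℝ} (hT : 0 < T)
    {δ : ℝ} (hδ : 0 < δ) (hδT : δ ≤ T) :
    ∃ C : ℝ, ∀ z : H, ‖(S δ).adjoint z‖ ≤ C * ‖hS.weightedObservation K hT z‖ := by
  obtain ⟨C, hC0, hC⟩ := hS.observability K hnull hδ
  refine ⟨C, fun z => (hC z).trans (mul_le_mul_of_nonneg_left ?_ hC0)⟩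
  rw [Lp.norm_def]
  refine ENNReal.toReal_mono (Lp.eLpNorm_ne_top _) ?_
  refine (eLpNorm_mono_measure _ (Measure.restrict_mono (Ioo_subset_Ioo_right hδT) le_rfl)).trans
    (eLpNorm_mono_ae ?_)
  filter_upwards [hS.coeFn_weightedObservation K hT z, ae_restrict_mem measurableSet_Ioo]
    with r h1 hr
  rw [h1]
  exact norm_le_norm_scaleSnd (one_le_sqrt_weight hr) _

/-- Every limit in `L²` of observations is the observation of a trajectory that is analytic up to
the singular time `r = 0`. -/
theorem exists_analytic_of_mem_closure (hS : IsAnalyticSemigroup A S)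
    (K : WithLp 2 (U₁ × U₂) →L[𝕜] H) (hnull : NullControllable A K) {T : ℝ} (hT : 0 < T)
    {p : Lp (WithLp 2 (U₁ × U₂)) 2 (volume.restrict (Ioo 0 T))}
    (hp : p ∈ (LinearMap.range (hS.weightedObservation K hT)).topologicalClosure) :
    ∃ ζ : ℝ → H, AnalyticOnNhd ℝ ζ (Ioi 0) ∧ ∀ᵐ r ∂(volume.restrict (Ioo 0 T)),
      p r = scaleSnd 𝕜 (√(T + 1 - r)) (K.adjoint (ζ r)) := by
  rw [← SetLike.mem_coe, Submodule.topologicalClosure_coe, mem_closure_iff_seq_limit] at hp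
  obtain ⟨q, hq, hlim⟩ := hp
  choose z hz using hq
  have hcauchy : ∀ r : ℝ, 0 < r → CauchySeq fun n => (S r).adjoint (z n) := by
    intro r hr
    -- Convergence at time δ ≤ T is transported to r by S(r - δ)*. This also covers r > T, which is
    -- essential because the tie argument looks beyond T + 1.
    set δ := min r T
    have hδ : 0 < δ := lt_min hr hT
    obtain ⟨C, hC⟩ := hS.exists_norm_adjoint_le_weightedObservation K hnull hT hδ (min_le_right _ _)
    have hCδ : CauchySeq fun n => (S δ).adjoint (z n) := by
      refine cauchySeq_iff_tendsto_dist_atTop_0.2 ?_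
      have h1 := (cauchySeq_iff_tendsto_dist_atTop_0.1 hlim.cauchySeq).const_mul C
      rw [mul_zero] at h1
      refine squeeze_zero (fun _ => dist_nonneg) (fun n => ?_) h1
      rw [dist_eq_norm, dist_eq_norm, ← map_sub, ← hz, ← hz, ← map_sub]
      exact hC _
    have h2 : ∀ n, (S r).adjoint (z n) = (S (r - δ)).adjoint ((S δ).adjoint (z n)) := fun n => by
      rw [← hS.adjoint_add_apply (sub_nonneg.2 (min_le_left _ _)) hδ.le, sub_add_cancel]
    simp only [h2]
    exact hCδ.map ((S (r - δ)).adjoint.uniformContinuous)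
  have hex : ∀ r : ℝ, ∃ w : H, 0 < r →
      Filter.Tendsto (fun n => (S r).adjoint (z n)) Filter.atTop (nhds w) := by
    intro r
    by_cases hr : 0 < r
    · obtain ⟨w, hw⟩ := cauchySeq_tendsto_of_complete (hcauchy r hr)
      exact ⟨w, fun _ => hw⟩
    · exact ⟨0, fun h => absurd h hr⟩
  choose ζ hζ using hex
  refine ⟨ζ, fun r hr => ?_, ?_⟩
  -- Near r the limit is the adjoint orbit of its own value at r / 2, hence analytic.
  · have hr0 : 0 < r := hr
    have hshift : ∀ᶠ s in nhds r, (S (s - r / 2)).adjoint (ζ (r / 2)) = ζ s := by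
      filter_upwards [lt_mem_nhds (show r / 2 < r by linarith)] with s hs
      refine tendsto_nhds_unique ?_ (hζ s (by linarith))
      have h2 : ∀ n, (S s).adjoint (z n) =
          (S (s - r / 2)).adjoint ((S (r / 2)).adjoint (z n)) := fun n => by
        rw [← hS.adjoint_add_apply (by linarith) (by linarith), sub_add_cancel]
      simp only [h2]
      exact (((S (s - r / 2)).adjoint).continuous.tendsto _).comp (hζ (r / 2) (by linarith))
    refine AnalyticAt.congr ?_ hshift
    exact AnalyticAt.fun_comp (g := fun t => (S t).adjoint (ζ (r / 2))) (f := fun s => s - r / 2)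
      (hS.analytic _ _ (by simp only [mem_Ioi]; linarith)) (analyticAt_id.sub analyticAt_const)
  · obtain ⟨ns, hns, hae⟩ := (tendstoInMeasure_of_tendsto_Lp hlim).exists_seq_tendsto_ae
    have hall : ∀ᵐ r ∂(volume.restrict (Ioo 0 T)), ∀ n,
        q n r = scaleSnd 𝕜 (√(T + 1 - r)) (K.adjoint ((S r).adjoint (z n))) :=
      ae_all_iff.2 fun n => by rw [← hz n]; exact hS.coeFn_weightedObservation K hT (z n)
    filter_upwards [hae, hall, ae_restrict_mem measurableSet_Ioo] with r h1 h2 hr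
    refine tendsto_nhds_unique h1 ?_
    simp only [h2]
    have hc : Continuous fun x => scaleSnd 𝕜 (√(T + 1 - r)) (K.adjoint x) :=
      continuous_scaleSnd.comp (continuous_const.prodMk K.adjoint.continuous)
    exact (hc.tendsto _).comp ((hζ r hr.1).comp hns.tendsto_atTop)

variable [IsScalarTower ℝ 𝕜 H]

theorem exists_switching_control (hS : IsAnalyticSemigroup A S)
    (K : WithLp 2 (U₁ × U₂) →L[𝕜] H) (hnull : NullControllable A K) {T : ℝ} (hT : 0 < T) :
    ∃ C : ℝ, ∀ y₀ : H, ∃ u : ℝ → WithLp 2 (U₁ × U₂), MemLp u 2 (volume.restrict (Ioo 0 T)) ∧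
      (∃ y : ℝ → H, IsSolution A (fun t => K (u t)) T y₀ y ∧ y T = 0) ∧
      (∀ᵐ t ∂(volume.restrict (Ioo 0 T)), (u t).fst = 0 ∨ (u t).snd = 0) ∧
      (eLpNorm u 2 (volume.restrict (Ioo 0 T))).toReal ≤ C * ‖y₀‖ := by
  obtain ⟨C, hC⟩ := hnull T hT
  -- T + 1 bounds the weight, 8 comes from the switching representative, and division by the weight
  -- costs nothing.
  refine ⟨(T + 1) * (8 * C), fun y₀ => ?_⟩
  obtain ⟨u₀, hu₀, ⟨y, hy, hyT⟩, hun⟩ := hC y₀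
  obtain ⟨hr₀, hr₀n⟩ := memLp_comp_const_sub hu₀
  have hdual := hS.duality_of_isSolution K hT.le hu₀ hy hyT
  have hinv : ∀ r ∈ Ioo 0 T, 0 ≤ (√(T + 1 - r))⁻¹ ∧ (√(T + 1 - r))⁻¹ ≤ 1 := fun r hr =>
    ⟨by positivity, inv_le_one_of_one_le₀ (one_le_sqrt_weight hr)⟩
  -- The weight is symmetric, so dividing the reversed control by it compensates for the weight in
  -- the observation. The representative is multiplied by the weight again below.
  have hw₀ : MemLp (fun r => scaleSnd 𝕜 (√(T + 1 - r))⁻¹ (u₀ (T - r))) 2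
      (volume.restrict (Ioo 0 T)) := hr₀.scaleSnd (by fun_prop) le_rfl hinv
  obtain ⟨v, hv, hsw, hvn⟩ := exists_switching_representative
    (LinearMap.range (hS.weightedObservation K hT)).topologicalClosure
    (Submodule.isClosed_topologicalClosure _) (fun p hp => by
      obtain ⟨ζ, hζ, hpζ⟩ := hS.exists_analytic_of_mem_closure K hnull hT hp
      filter_upwards [hpζ, ae_scaleSnd_eq_zero_or_norm_ne hζ K.adjoint
        (show 0 < T + 1 by linarith) (show T ≤ T + 1 by linarith)] with r h1 h2
      rwa [h1]) (hw₀.toLp _)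
  have hw : MemLp (fun r => scaleSnd 𝕜 (√(T + 1 - r)) (v r)) 2
      (volume.restrict (Ioo 0 T)) :=
    (Lp.memLp v).scaleSnd (by fun_prop) (by linarith : 1 ≤ T + 1)
      fun _ hr => ⟨Real.sqrt_nonneg _, sqrt_weight_le hr⟩
  have hdualw : ∀ z, ∫ r in Ioo 0 T, inner 𝕜 (K.adjoint ((S r).adjoint z))
      (scaleSnd 𝕜 (√(T + 1 - r)) (v r)) = -inner 𝕜 ((S T).adjoint z) y₀ := by
    intro z
    rw [← hdual z]
    have h := hv (hS.weightedObservation K hT z)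
      (Submodule.le_topologicalClosure _ (LinearMap.mem_range_self _ z))
    rw [L2.inner_def, L2.inner_def] at h
    convert h using 1
    · refine integral_congr_ae ?_
      filter_upwards [hS.coeFn_weightedObservation K hT z] with r h1
      rw [h1, inner_scaleSnd_left]
    · refine integral_congr_ae ?_
      filter_upwards [hS.coeFn_weightedObservation K hT z, hw₀.coeFn_toLp,
        ae_restrict_mem measurableSet_Ioo] with r h1 h2 hr
      rw [h1, h2, inner_scaleSnd_left, scaleSnd_scaleSnd_inv]
      exact (zero_lt_one.trans_le (one_le_sqrt_weight hr)).ne'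
  obtain ⟨hu, hun'⟩ := memLp_comp_const_sub hw
  refine ⟨_, hu, hS.exists_isSolution_of_duality K hT.le hw hdualw, ?_, ?_⟩
  · filter_upwards [(measurePreserving_const_sub_Ioo T).quasiMeasurePreserving.ae hsw] with t ht
    rcases ht with h | h
    · exact .inl h
    · exact .inr (by rw [scaleSnd, WithLp.toLp_snd, h, smul_zero])
  · rw [hun', ← Lp.norm_toLp _ hw]
    have h1 : ‖hw.toLp _‖ ≤ (T + 1) * ‖v‖ := Lp.norm_le_mul_norm_of_ae_le_mul <| by
      filter_upwards [hw.coeFn_toLp, ae_restrict_mem measurableSet_Ioo] with r h1 hr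
      rw [h1]
      exact norm_scaleSnd_le_of_le (Real.sqrt_nonneg _) (by linarith) (sqrt_weight_le hr) _
    have h2 : ‖hw₀.toLp _‖ ≤ ‖hr₀.toLp _‖ := Lp.norm_le_norm_of_ae_le <| by
      filter_upwards [hw₀.coeFn_toLp, hr₀.coeFn_toLp, ae_restrict_mem measurableSet_Ioo]
        with r h1 h2 hr
      rw [h1, h2]
      simpa using norm_scaleSnd_le_of_le (hinv r hr).1 le_rfl (hinv r hr).2 (u₀ (T - r))
    rw [Lp.norm_toLp _ hr₀, hr₀n] at h2
    calc _ ≤ (T + 1) * (8 * (C * ‖y₀‖)) :=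
          h1.trans (mul_le_mul_of_nonneg_left (hvn.trans (by linarith)) (by linarith))
      _ = _ := by ring

end IsAnalyticSemigroup

end Control

/-! ### Uniqueness for Volterra equations -/

section Volterra

theorem eq_zero_of_eq_intervalIntegral {F : Type*} [NormedAddCommGroup F] [NormedSpace ℝ F]
    [CompleteSpace F] {N : F → F} (hN : Continuous N) {K : ℝ} (hK : ∀ x, ‖N x‖ ≤ K * ‖x‖)
    {T : ℝ} {v : ℝ → F} (hv : ContinuousOn v (Icc 0 T))
    (h : ∀ t ∈ Icc 0 T, v t = ∫ s in (0 : ℝ)..t, N (v s)) : ∀ t ∈ Icc 0 T, v t = 0 := by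
  intro t ht
  have hT : 0 ≤ T := ht.1.trans ht.2
  -- A continuous extension to the line makes the primitive `V` differentiable at the endpoints too,
  -- ready for Grönwall.
  set w := IccExtend hT ((Icc 0 T).domRestrict v) with hw
  have hwc : Continuous w := (continuousOn_iff_continuous_domRestrict.1 hv).Icc_extend'
  have hwv : EqOn w v (Icc 0 T) := fun s hs => by rw [hw, IccExtend_of_mem _ _ hs]; rfl
  set V : ℝ → F := fun t => ∫ s in (0 : ℝ)..t, N (w s) with hV
  have hVw : EqOn V w (Icc 0 T) := fun s hs => by
    rw [hwv hs, h s hs]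
    refine intervalIntegral.integral_congr fun r hr => ?_
    rw [uIcc_of_le hs.1] at hr
    simp only [hwv ⟨hr.1, hr.2.trans hs.2⟩]
  have hd : ∀ s, HasDerivAt V (N (w s)) s := fun s =>
    intervalIntegral.integral_hasDerivAt_right ((hN.comp hwc).intervalIntegrable _ _)
      ((hN.comp hwc).stronglyMeasurableAtFilter _ _) (hN.comp hwc).continuousAt
  have hz := norm_le_gronwallBound_of_norm_deriv_right_le (f := V) (δ := 0) (K := K) (ε := 0)
    (a := 0) (b := T) (fun s _ => (hd s).continuousAt.continuousWithinAt)
    (fun s _ => (hd s).hasDerivWithinAt) (by simp [hV])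
    (fun s hs => by rw [hVw (Ico_subset_Icc_self hs), add_zero]; exact hK _) t ht
  rw [gronwallBound_ε0_δ0, hVw ht, hwv ht] at hz
  exact norm_le_zero_iff.1 hz

end Volterra

/-! ### Semigroups in finite dimension -/

section FiniteDimensional

variable {𝕜 H : Type*} [RCLike 𝕜] [NormedAddCommGroup H] [InnerProductSpace 𝕜 H]
  [CompleteSpace H] [NormedSpace ℝ H] [IsScalarTower ℝ 𝕜 H]

theorem hasDerivAt_exp_smul_apply (N : H →L[𝕜] H) (x : H) (t : ℝ) :
    HasDerivAt (fun s : ℝ => NormedSpace.exp ((s : 𝕜) • N) x)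
      (N (NormedSpace.exp ((t : 𝕜) • N) x)) t := by
  have h1 : HasDerivAt (fun c : 𝕜 => NormedSpace.exp (c • N) x)
      (N (NormedSpace.exp ((t : 𝕜) • N) x)) (t : 𝕜) :=
    (hasDerivAt_exp_smul_const' N (t : 𝕜)).clm_apply (hasDerivAt_const _ x) |>.congr_deriv (by simp)
  have h2 : HasDerivAt (fun s : ℝ => (s : 𝕜)) 1 t := by
    simpa using (RCLike.ofRealCLM (K := 𝕜)).hasDerivAt (x := t)
  simpa [Function.comp_def] using h1.scomp t h2

/-- On a finite-dimensional space, every everywhere defined operator generates a semigroup. -/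
theorem exists_isAnalyticSemigroup_of_finiteDimensional [FiniteDimensional 𝕜 H] (A : H →ₗ.[𝕜] H)
    (hA : A.domain = ⊤) : ∃ S : ℝ → H →L[𝕜] H, IsAnalyticSemigroup A S := by
  have hmem : ∀ x, x ∈ A.domain := fun x => hA ▸ Submodule.mem_top
  have hdense : Dense (A.domain : Set H) := by rw [hA]; exact dense_univ
  set N : H →L[𝕜] H := LinearMap.toContinuousLinearMap
    { toFun := fun x => -A ⟨x, hmem x⟩
      map_add' := fun x y => by
        rw [← neg_add, ← A.map_add]; rfl
      map_smul' := fun c x => by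
        rw [RingHom.id_apply, smul_neg, ← A.map_smul]; rfl }
  have hN : ∀ x, N x = -A ⟨x, hmem x⟩ := fun x => rfl
  have hadj : ∀ (z : A.adjoint.domain) (x : H),
      inner 𝕜 (A.adjoint z) x = -inner 𝕜 (z : H) (N x) := fun z x => by
    rw [hN, inner_neg_right, neg_neg]
    exact A.adjoint_isFormalAdjoint hdense z ⟨x, hmem x⟩
  have hdom : ∀ z : H, z ∈ A.adjoint.domain := fun z => by
    refine LinearPMap.mem_adjoint_domain_of_exists z ⟨-N.adjoint z, fun x => ?_⟩
    rw [inner_neg_left, ContinuousLinearMap.adjoint_inner_left, hN, inner_neg_right, neg_neg]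
  let _ : NormedAlgebra ℚ (H →L[𝕜] H) := NormedAlgebra.restrictScalars ℚ 𝕜 _
  have hSc : Continuous fun t : ℝ => NormedSpace.exp ((t : 𝕜) • N) :=
    NormedSpace.exp_continuous.comp
      ((RCLike.continuous_ofReal (K := 𝕜)).smul (continuous_const (y := N)))
  refine ⟨fun t => NormedSpace.exp ((t : 𝕜) • N), ?_, ?_, ?_, ?_, ?_, ?_, ?_⟩
  · exact (hSc.comp continuous_fst).clm_apply continuous_snd
  · simp
  · intro s t _ _
    rw [RCLike.ofReal_add, add_smul, NormedSpace.exp_add_of_commute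
      (((Commute.refl N).smul_left _).smul_right _)]
    rfl
  · intro T
    obtain ⟨M, hM⟩ := isCompact_Icc.exists_bound_of_continuousOn (s := Icc 0 T) hSc.continuousOn
    exact ⟨M, hM⟩
  · intro z t _ x
    simp only [hadj]
    have hd : ∀ s ∈ uIcc 0 t, HasDerivAt
        (fun s : ℝ => inner 𝕜 (z : H) (NormedSpace.exp ((s : 𝕜) • N) x))
        (inner 𝕜 (z : H) (N (NormedSpace.exp ((s : 𝕜) • N) x))) s := fun s _ =>
      (((innerSL 𝕜 (z : H)).restrictScalars ℝ).hasFDerivAt).comp_hasDerivAt s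
        (hasDerivAt_exp_smul_apply N x s)
    have hc : Continuous fun s : ℝ => inner 𝕜 (z : H) (N (NormedSpace.exp ((s : 𝕜) • N) x)) :=
      continuous_const.inner (N.continuous.comp (hSc.clm_apply continuous_const))
    rw [intervalIntegral.integral_neg, intervalIntegral.integral_eq_sub_of_hasDerivAt hd
      (hc.intervalIntegrable _ _)]
    simp
  · intro T d hd h
    refine eq_zero_of_eq_intervalIntegral N.continuous (K := ‖N‖) N.le_opNorm hd fun t ht => ?_
    refine ext_inner_left 𝕜 fun z => ?_
    have hi : IntervalIntegrable (fun s => N (d s)) volume 0 t :=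
      ContinuousOn.intervalIntegrable_of_Icc ht.1
        (N.continuous.comp_continuousOn (hd.mono (Icc_subset_Icc_right ht.2)))
    have h1 := h ⟨z, hdom z⟩ t ht
    simp only [hadj, intervalIntegral.integral_neg, neg_neg] at h1
    rw [h1]
    exact (innerSL 𝕜 z).intervalIntegral_comp_comm hi
  · intro z t _
    -- For real t the adjoint of exp(tN) is exp(tN*), whose orbits are analytic as a power series in
    -- the scalar.
    have h1 : (fun t : ℝ => (NormedSpace.exp ((t : 𝕜) • N)).adjoint z) =
        fun t : ℝ => NormedSpace.exp ((t : 𝕜) • N.adjoint) z := by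
      ext1 t
      rw [← ContinuousLinearMap.star_eq_adjoint, NormedSpace.star_exp, star_smul,
        ContinuousLinearMap.star_eq_adjoint]
      simp
    simp only [h1]
    have h2 : AnalyticAt 𝕜 (fun c : 𝕜 => NormedSpace.exp (c • N.adjoint) z) (t : 𝕜) := by
      have h3 : AnalyticAt 𝕜 (fun c : 𝕜 => NormedSpace.exp (c • N.adjoint)) (t : 𝕜) :=
        AnalyticAt.fun_comp (g := NormedSpace.exp) (f := fun c : 𝕜 => c • N.adjoint)
          (NormedSpace.exp_analytic _) (analyticAt_id.smul analyticAt_const)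
      exact AnalyticAt.fun_comp (g := fun L : H →L[𝕜] H => L z)
        ((ContinuousLinearMap.apply 𝕜 H z).analyticAt _) h3
    exact AnalyticAt.fun_comp (g := fun c : 𝕜 => NormedSpace.exp (c • N.adjoint) z)
      (f := fun s : ℝ => (s : 𝕜)) h2.restrictScalars ((RCLike.ofRealCLM (K := 𝕜)).analyticAt t)

end FiniteDimensional

/-! ### Eigenbasis of a positive operator with compact resolvent -/

section SelfAdjoint

universe u v

variable {𝕜 : Type u} {H : Type v} [RCLike 𝕜] [NormedAddCommGroup H] [InnerProductSpace 𝕜 H]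
  [CompleteSpace H]

/-- Moves the resolvent from an arbitrary μ to the real point -1, where the inverse inherits the
symmetry of A. By the Fredholm alternative, 1 - (μ + 1)R can fail to be invertible only if some
nonzero y satisfies A y = -y, which positivity forbids. -/
theorem HasCompactResolvent.exists_inverse_add_one {A : H →ₗ.[𝕜] H} (hpos : IsPosDef A)
    (hres : HasCompactResolvent A) : ∃ Q : H →L[𝕜] H, IsCompactOperator Q ∧
      ∀ x, ∃ h : Q x ∈ A.domain, A ⟨Q x, h⟩ + Q x = x := by
  obtain ⟨μ, R, hRc, hR, -⟩ := hres
  choose hmem hR using hR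
  have hA : ∀ x, A ⟨R x, hmem x⟩ + R x = -(x - (μ + 1) • R x) := fun x => by
    rw [← sub_eq_iff_eq_add'.2 (sub_eq_iff_eq_add.1 (hR x)), add_smul, one_smul]
    abel
  have hunit : ∃ V : H →L[𝕜] H, ∀ x, V x - (μ + 1) • R (V x) = x := by
    rcases eq_or_ne (μ + 1) 0 with h0 | h0
    · exact ⟨1, fun x => by simp [h0]⟩
    · rcases hRc.hasEigenvalue_or_mem_resolventSet (inv_ne_zero h0) with he | hr
      · exfalso
        obtain ⟨x, hx, hx0⟩ := he.exists_hasEigenvector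
        rw [Module.End.mem_eigenspace_iff] at hx
        have hx' : (μ + 1) • R x = x := by
          rw [show R x = (μ + 1)⁻¹ • x from hx, smul_inv_smul₀ h0]
        have h1 := hA x
        rw [hx', sub_self, neg_zero] at h1
        have hRx0 : R x ≠ 0 := fun h => hx0 (by rw [← hx', h, smul_zero])
        have h2 := hpos ⟨R x, hmem x⟩ hRx0
        rw [eq_neg_of_add_eq_zero_left h1, inner_neg_left, map_neg, inner_self_eq_norm_sq] at h2
        linarith [sq_nonneg ‖R x‖]
      · rw [spectrum.mem_resolventSet_iff] at hr
        obtain ⟨V, hV⟩ := hr.exists_right_inv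
        refine ⟨(μ + 1)⁻¹ • V, fun x => ?_⟩
        have h1 := DFunLike.congr_fun hV x
        simp only [Algebra.algebraMap_eq_smul_one, mul_apply_eq_comp,
          sub_apply, smul_apply,
          one_apply_eq_self] at h1
        simp only [smul_apply, map_smul, smul_inv_smul₀ h0]
        exact h1
  obtain ⟨V, hV⟩ := hunit
  refine ⟨-(R.comp V), (hRc.comp_clm V).neg, fun x => ?_⟩
  have hm : (-(R.comp V)) x ∈ A.domain := A.domain.neg_mem (hmem (V x))
  refine ⟨hm, ?_⟩
  have h1 : (⟨(-(R.comp V)) x, hm⟩ : A.domain) = -⟨R (V x), hmem (V x)⟩ := rfl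
  rw [h1, LinearPMap.map_neg]
  have h2 := hA (V x)
  rw [hV] at h2
  rw [neg_apply, ContinuousLinearMap.comp_apply, ← neg_add, h2, neg_neg]

/-- Hilbert bases of all the eigenspaces are glued, trivial ones contributing nothing. The
eigenspaces are mutually orthogonal and, by the spectral theorem for compact symmetric operators, no
nonzero vector is orthogonal to all of them; the kernel may be infinite-dimensional. -/
theorem exists_hilbertBasis_eigenvectors {Q : H →L[𝕜] H} (hQc : IsCompactOperator Q)
    (hQ : (Q : H →ₗ[𝕜] H).IsSymmetric) :
    ∃ (ι : Type (max u v)) (e : HilbertBasis ι 𝕜 H) (σ : ι → 𝕜), ∀ i, Q (e i) = σ i • e i := by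
  have hcl : ∀ σ : 𝕜, IsClosed (Module.End.eigenspace (Q : H →ₗ[𝕜] H) σ : Set H) := fun σ => by
    have : (Module.End.eigenspace (Q : H →ₗ[𝕜] H) σ : Set H) = {x | Q x = σ • x} := by
      ext x; exact Module.End.mem_eigenspace_iff
    rw [this]
    exact isClosed_eq Q.continuous (continuous_const_smul σ)
  have hcomp : ∀ σ : 𝕜, CompleteSpace (Module.End.eigenspace (Q : H →ₗ[𝕜] H) σ) := fun σ =>
    (hcl σ).completeSpace_coe
  choose w b _ using fun σ : 𝕜 => exists_hilbertBasis 𝕜 (Module.End.eigenspace (Q : H →ₗ[𝕜] H) σ)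
  set v : (Σ σ, w σ) → H := fun a => (b a.1 a.2 : H) with hv
  have hon : Orthonormal 𝕜 v :=
    hQ.orthogonalFamily_eigenspaces.orthonormal_sigma_orthonormal fun σ => (b σ).orthonormal
  have hbot : (Submodule.span 𝕜 (range v))ᗮ = ⊥ := by
    rw [eq_bot_iff, ← ContinuousLinearMap.orthogonalComplement_iSup_eigenspaces_eq_bot hQc hQ]
    intro x hx
    rw [← Submodule.iInf_orthogonal, Submodule.mem_iInf]
    intro σ y hy
    have hext : (innerSL 𝕜 x).comp (Module.End.eigenspace (Q : H →ₗ[𝕜] H) σ).subtypeL = 0 := by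
      refine ContinuousLinearMap.ext_on (s := range (b σ)) ?_ ?_
      · rw [dense_iff_closure_eq, ← Submodule.topologicalClosure_coe, (b σ).dense_span]
        rfl
      · rintro _ ⟨a, rfl⟩
        have hmem : ((b σ a : _) : H) ∈ Submodule.span 𝕜 (range v) :=
          Submodule.subset_span ⟨Sigma.mk σ a, rfl⟩
        exact Submodule.inner_left_of_mem_orthogonal hmem hx
    have h1 : inner 𝕜 x y = 0 := DFunLike.congr_fun hext ⟨y, hy⟩
    rw [← inner_conj_symm, h1, map_zero]
  refine ⟨Σ σ, w σ, HilbertBasis.mkOfOrthogonalEqBot hon hbot, fun a => a.1, fun a => ?_⟩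
  rw [HilbertBasis.coe_mkOfOrthogonalEqBot]
  exact Module.End.mem_eigenspace_iff.1 (b a.1 a.2).2

/-- A symmetric positive definite operator with compact resolvent has an eigenbasis. -/
theorem exists_hilbertBasis_of_hasCompactResolvent {A : H →ₗ.[𝕜] H} (hsymm : A.IsFormalAdjoint A)
    (hpos : IsPosDef A) (hres : HasCompactResolvent A) :
    ∃ (ι : Type (max u v)) (e : HilbertBasis ι 𝕜 H) (l : ι → ℝ), (∀ i, 0 ≤ l i) ∧
      ∀ i, ∃ h : e i ∈ A.domain, A ⟨e i, h⟩ = (l i : 𝕜) • e i := by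
  obtain ⟨Q, hQc, hQ⟩ := hres.exists_inverse_add_one hpos
  choose hmem hQ using hQ
  have hQs : (Q : H →ₗ[𝕜] H).IsSymmetric := fun x y => by
    change inner 𝕜 (Q x) y = inner 𝕜 x (Q y)
    conv_lhs => rw [← hQ y]
    conv_rhs => rw [← hQ x]
    rw [inner_add_left, inner_add_right]
    congr 1
    exact (hsymm ⟨Q x, hmem x⟩ ⟨Q y, hmem y⟩).symm
  obtain ⟨ι, e, σ, he⟩ := exists_hilbertBasis_eigenvectors hQc hQs
  have hne : ∀ i, e i ≠ 0 := fun i h => by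
    have := e.orthonormal.norm_eq_one i
    rw [h, norm_zero] at this
    exact zero_ne_one this
  -- Q is injective, being a right inverse of A + 1. Hence A has eigenvalue σ⁻¹ - 1 on `e i`.
  have hσ : ∀ i, σ i ≠ 0 := fun i h => by
    have h1 := hQ (e i)
    have h0 : Q (e i) = 0 := by rw [he, h, zero_smul]
    have h2 : (⟨Q (e i), hmem (e i)⟩ : A.domain) = 0 := Subtype.ext h0
    rw [h2, LinearPMap.map_zero, h0, add_zero] at h1
    exact hne i h1.symm
  have hei : ∀ i, e i = Q ((σ i)⁻¹ • e i) := fun i => by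
    rw [map_smul, he, inv_smul_smul₀ (hσ i)]
  have hdom : ∀ i, e i ∈ A.domain := fun i => by
    rw [hei]; exact hmem _
  have hAe : ∀ i, A ⟨e i, hdom i⟩ = ((σ i)⁻¹ - 1) • e i := fun i => by
    have h1 : (⟨e i, hdom i⟩ : A.domain) = ⟨Q ((σ i)⁻¹ • e i), hmem _⟩ := Subtype.ext (hei i)
    rw [h1, eq_sub_of_add_eq (hQ ((σ i)⁻¹ • e i)), ← hei, sub_smul, one_smul]
  have hinner : ∀ i, inner 𝕜 (e i) (e i) = (1 : 𝕜) := fun i => by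
    rw [inner_self_eq_norm_sq_to_K, e.orthonormal.norm_eq_one]; simp
  have hreal : ∀ i, ((RCLike.re ((σ i)⁻¹ - 1) : ℝ) : 𝕜) = (σ i)⁻¹ - 1 := fun i => by
    have h1 := hsymm ⟨e i, hdom i⟩ ⟨e i, hdom i⟩
    rw [hAe, inner_smul_left, inner_smul_right, hinner, mul_one, mul_one] at h1
    exact RCLike.conj_eq_iff_re.1 h1
  refine ⟨ι, e, fun i => RCLike.re ((σ i)⁻¹ - 1), fun i => ?_, fun i => ⟨hdom i, ?_⟩⟩
  · have h1 := hpos ⟨e i, hdom i⟩ (hne i)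
    rw [hAe, inner_smul_left, hinner, mul_one, RCLike.conj_re] at h1
    exact h1.le
  · rw [hreal, hAe]

end SelfAdjoint

/-! ### Diagonal operators and diagonal semigroups -/

section Coordinates

variable {𝕜 H ι : Type*} [RCLike 𝕜] [NormedAddCommGroup H] [InnerProductSpace 𝕜 H]

/-- The operator multiplying the coordinates in a Hilbert basis by a bounded sequence. -/
theorem exists_diagonal (e : HilbertBasis ι 𝕜 H) {m : ι → ℝ} {C : ℝ} (hC : 0 ≤ C)
    (hm : ∀ i, |m i| ≤ C) : ∃ D : H →L[𝕜] H, ‖D‖ ≤ C ∧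
      ∀ x i, inner 𝕜 (e i) (D x) = m i * inner 𝕜 (e i) x := by
  have hmK : ∀ i, ‖(m i : 𝕜) • (1 : 𝕜 →L[𝕜] 𝕜)‖ ≤ C := fun i => by
    rw [norm_smul, RCLike.norm_ofReal, norm_one, mul_one]
    exact hm i
  set M := lp.mapCLM (𝕜 := 𝕜) 2 (fun i => (m i : 𝕜) • (1 : 𝕜 →L[𝕜] 𝕜)) hC hmK
  have hM : ‖M‖ ≤ C := lp.norm_mapCLM_le 2 _ hC hmK
  refine ⟨(e.repr.symm : _ →L[𝕜] H).comp (M.comp (e.repr : H →L[𝕜] _)),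
    ContinuousLinearMap.opNorm_le_bound _ hC fun x => ?_, fun x i => ?_⟩
  · change ‖e.repr.symm (M (e.repr x))‖ ≤ C * ‖x‖
    rw [LinearIsometryEquiv.norm_map, ← e.repr.norm_map x]
    exact M.le_of_opNorm_le hM _
  · change inner 𝕜 (e i) (e.repr.symm (M (e.repr x))) = _
    rw [← e.repr_apply_apply, ← e.repr_apply_apply, LinearIsometryEquiv.apply_symm_apply]
    rfl

theorem HilbertBasis.ext_inner (e : HilbertBasis ι 𝕜 H) {x y : H}
    (h : ∀ i, inner 𝕜 (e i) x = inner 𝕜 (e i) y) : x = y := by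
  apply e.repr.injective
  ext i
  rw [e.repr_apply_apply, e.repr_apply_apply, h]

end Coordinates

section Diagonal

variable {𝕜 H ι : Type*} [RCLike 𝕜] [NormedAddCommGroup H] [InnerProductSpace 𝕜 H]
  [CompleteSpace H]

theorem HilbertBasis.apply_eq_smul (e : HilbertBasis ι 𝕜 H) {D : H →L[𝕜] H} {m : ι → ℝ}
    (hD : ∀ x i, inner 𝕜 (e i) (D x) = m i * inner 𝕜 (e i) x) (i : ι) :
    D (e i) = (m i : 𝕜) • e i := by
  classical
  refine e.ext_inner fun j => ?_
  rw [hD, inner_smul_right, orthonormal_iff_ite.1 e.orthonormal]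
  split_ifs with h
  · rw [h]
  · simp

theorem HilbertBasis.adjoint_apply_eq (e : HilbertBasis ι 𝕜 H) {D : H →L[𝕜] H} {m : ι → ℝ}
    (hD : ∀ x i, inner 𝕜 (e i) (D x) = m i * inner 𝕜 (e i) x) (x : H) : D.adjoint x = D x := by
  refine e.ext_inner fun i => ?_
  rw [ContinuousLinearMap.adjoint_inner_right, e.apply_eq_smul hD, inner_smul_left, hD,
    RCLike.conj_ofReal]

/-- Continuity is clear on finite combinations of basis vectors and passes to their closure because
the operators are uniformly bounded. -/
theorem HilbertBasis.continuous_diagonal_apply (e : HilbertBasis ι 𝕜 H) {D : ℝ → H →L[𝕜] H}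
    {m : ℝ → ι → ℝ} (hD : ∀ t x i, inner 𝕜 (e i) (D t x) = m t i * inner 𝕜 (e i) x)
    (hm : ∀ i, Continuous fun t => m t i) (hD1 : ∀ t, ‖D t‖ ≤ 1) (x : H) :
    Continuous fun t => D t x := by
  have hspan : ∀ y ∈ Submodule.span 𝕜 (range e), Continuous fun t => D t y := by
    intro y hy
    induction hy using Submodule.span_induction with
    | mem y hy =>
      obtain ⟨i, rfl⟩ := hy
      simp only [e.apply_eq_smul (hD _)]
      exact (RCLike.continuous_ofReal.comp (hm i)).smul continuous_const
    | zero => simpa using continuous_const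
    | add y z _ _ hy hz => simpa only [map_add] using hy.fun_add hz
    | smul c y _ hy => simpa only [map_smul] using hy.fun_const_smul c
  refine continuous_of_uniform_approx_of_continuous fun u hu => ?_
  obtain ⟨ε, hε, hεu⟩ := Metric.mem_uniformity_dist.1 hu
  have hx : x ∈ closure (Submodule.span 𝕜 (range e) : Set H) := by
    rw [← Submodule.topologicalClosure_coe, e.dense_span]; trivial
  obtain ⟨y, hy, hxy⟩ := Metric.mem_closure_iff.1 hx ε hε
  refine ⟨_, hspan y hy, fun t => hεu ?_⟩
  rw [dist_eq_norm, ← map_sub]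
  refine lt_of_le_of_lt ((D t).le_of_opNorm_le (hD1 t) _) ?_
  rwa [one_mul, ← dist_eq_norm]

variable [NormedSpace ℝ H] [IsScalarTower ℝ 𝕜 H]

/-- The left side is the n-th Taylor coefficient of s ↦ exp(-l s) at t. The bound follows from (l
t)ⁿ / n! ≤ exp(l t) and is uniform in l, so all coordinates share the radius of convergence t. -/
theorem pow_div_factorial_mul_exp_le {l t : ℝ} (hl : 0 ≤ l) (ht : 0 < t) (n : ℕ) :
    |(-l) ^ n / n.factorial * Real.exp (-l * t)| ≤ t⁻¹ ^ n := by
  rw [abs_mul, abs_div, abs_pow, abs_neg, abs_of_nonneg hl, Nat.abs_cast, Real.abs_exp]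
  have h1 := Real.pow_div_factorial_le_exp (l * t) (by positivity) n
  have h2 : l ^ n / n.factorial = (l * t) ^ n / n.factorial * t⁻¹ ^ n := by
    rw [mul_pow, inv_pow]; field_simp
  rw [h2, mul_right_comm]
  refine mul_le_of_le_one_left (by positivity) ?_
  calc _ ≤ Real.exp (l * t) * Real.exp (-l * t) := by gcongr
    _ = 1 := by rw [← Real.exp_add]; simp

/-- The Taylor coefficients assemble into operators of norm at most t⁻ⁿ. Their series converges for
|h| < t and its sum is identified in coordinates; |h| < t also keeps t + h positive. -/
theorem HilbertBasis.analyticAt_diagonal_exp (e : HilbertBasis ι 𝕜 H) {l : ι → ℝ}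
    (hl : ∀ i, 0 ≤ l i) {D : ℝ → H →L[𝕜] H}
    (hD : ∀ t, 0 ≤ t → ∀ x i,
      inner 𝕜 (e i) (D t x) = (Real.exp (-l i * t) : ℝ) * inner 𝕜 (e i) x)
    (x : H) {t : ℝ} (ht : 0 < t) : AnalyticAt ℝ (fun s => D s x) t := by
  choose a ha1 ha2 using fun n : ℕ => exists_diagonal e (m := fun i =>
    (-l i) ^ n / n.factorial * Real.exp (-l i * t)) (by positivity : 0 ≤ t⁻¹ ^ n)
    (fun i => pow_div_factorial_mul_exp_le (hl i) ht n)
  set p : FormalMultilinearSeries ℝ ℝ H :=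
    fun n => ContinuousMultilinearMap.mkPiRing ℝ (Fin n) (a n x) with hp
  have hcoeff : ∀ n : ℕ, p.coeff n = a n x := fun n => by
    simp [hp, FormalMultilinearSeries.coeff]
  refine ⟨p, ?_⟩
  rw [hasFPowerSeriesAt_iff]
  filter_upwards [Metric.ball_mem_nhds (0 : ℝ) ht] with h hh
  rw [mem_ball_zero_iff, Real.norm_eq_abs] at hh
  simp only [hcoeff]
  have hsum : Summable fun n : ℕ => h ^ n • a n x := by
    refine Summable.of_norm_bounded (g := fun n : ℕ => (|h| * t⁻¹) ^ n * ‖x‖)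
      ((summable_geometric_of_lt_one (by positivity) ?_).mul_right _) fun n => ?_
    · rwa [← div_eq_mul_inv, div_lt_one ht]
    · rw [norm_smul, norm_pow, Real.norm_eq_abs, mul_pow, mul_assoc]
      exact mul_le_mul_of_nonneg_left ((a n).le_of_opNorm_le (ha1 n) x) (by positivity)
  convert hsum.hasSum using 1
  refine e.ext_inner fun i => ?_
  rw [abs_lt] at hh
  rw [hD _ (by linarith)]
  have h1 := ((innerSL 𝕜 (e i)).hasSum hsum.hasSum)
  have h2 : HasSum (fun n : ℕ => (-l i * h) ^ n / n.factorial) (Real.exp (-l i * h)) := by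
    rw [Real.exp_eq_exp_ℝ]
    exact NormedSpace.expSeries_div_hasSum_exp _
  have h3 := ((RCLike.hasSum_ofReal 𝕜).2 (h2.mul_right (Real.exp (-l i * t)))).mul_right
    (inner 𝕜 (e i) x)
  have hterm : ∀ n, innerSL 𝕜 (e i) (h ^ n • a n x) =
      (((-l i * h) ^ n / n.factorial * Real.exp (-l i * t) : ℝ) : 𝕜) * inner 𝕜 (e i) x := by
    intro n
    rw [RCLike.real_smul_eq_coe_smul (K := 𝕜), innerSL_apply_apply, inner_smul_right, ha2,
      ← mul_assoc, ← RCLike.ofReal_mul]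
    congr 2
    rw [mul_pow]
    ring
  simp only [hterm] at h1
  rw [mul_add, Real.exp_add, mul_comm (Real.exp _)]
  exact h3.unique h1

/-- An operator with an eigenbasis and nonnegative eigenvalues generates a semigroup. -/
theorem exists_isAnalyticSemigroup_of_hilbertBasis {A : H →ₗ.[𝕜] H}
    (hdense : Dense (A.domain : Set H)) (hsymm : A.IsFormalAdjoint A) (e : HilbertBasis ι 𝕜 H)
    {l : ι → ℝ} (hl : ∀ i, 0 ≤ l i)
    (he : ∀ i, ∃ h : e i ∈ A.domain, A ⟨e i, h⟩ = (l i : 𝕜) • e i) :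
    ∃ S : ℝ → H →L[𝕜] H, IsAnalyticSemigroup A S := by
  choose hdom hAe using he
  -- Negative times are frozen at 0: the semigroup structure asks for continuity on the whole line,
  -- while exp(-l t) would be unbounded in l there.
  choose S hS1 hS using fun t : ℝ => exists_diagonal e (m := fun i => Real.exp (-l i * max t 0))
    zero_le_one (fun i => by
      rw [Real.abs_exp, Real.exp_le_one_iff]
      have := mul_nonneg (hl i) (le_max_right t 0)
      linarith)
  have hS0 : ∀ t, 0 ≤ t → ∀ x i,
      inner 𝕜 (e i) (S t x) = (Real.exp (-l i * t) : ℝ) * inner 𝕜 (e i) x := fun t ht x i => by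
    rw [hS, max_eq_left ht]
  have hSc : ∀ x, Continuous fun t => S t x := e.continuous_diagonal_apply hS
    (fun i => by fun_prop) hS1
  have hadj : ∀ (z : A.adjoint.domain) (i : ι),
      inner 𝕜 (A.adjoint z) (e i) = l i * inner 𝕜 (z : H) (e i) := fun z i => by
    rw [← inner_smul_right, ← hAe]
    exact A.adjoint_isFormalAdjoint hdense z ⟨e i, hdom i⟩
  have heig : ∀ i, ∀ x : A.domain, inner 𝕜 ((l i : 𝕜) • e i) (x : H) = inner 𝕜 (e i) (A x) :=
    fun i x => by rw [← hAe]; exact hsymm ⟨e i, hdom i⟩ x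
  have hedom : ∀ i, e i ∈ A.adjoint.domain := fun i =>
    LinearPMap.mem_adjoint_domain_of_exists _ ⟨_, heig i⟩
  have hAadj : ∀ i, A.adjoint ⟨e i, hedom i⟩ = (l i : 𝕜) • e i := fun i =>
    LinearPMap.adjoint_apply_eq hdense _ (heig i)
  refine ⟨S, ?_, ?_, ?_, fun T => ⟨1, fun t _ => hS1 t⟩, ?_, ?_, ?_⟩
  · refine continuous_prod_of_continuous_lipschitzWith' _ 1 (fun t => ?_) hSc
    exact (S t).lipschitz.weaken (NNReal.coe_le_coe.1 (hS1 t))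
  · ext x
    refine e.ext_inner fun i => ?_
    rw [hS0 0 le_rfl]
    simp
  · intro s t hs ht
    ext x
    refine e.ext_inner fun i => ?_
    rw [hS0 _ (add_nonneg hs ht), ContinuousLinearMap.comp_apply, hS0 _ hs, hS0 _ ht, ← mul_assoc,
      ← RCLike.ofReal_mul, ← Real.exp_add, mul_add]
  · intro z t ht x
    have hint : ∫ s in (0 : ℝ)..t, inner 𝕜 (A.adjoint z) (S s x) =
        inner 𝕜 (A.adjoint z) (∫ s in (0 : ℝ)..t, S s x) :=
      (innerSL 𝕜 (A.adjoint z)).intervalIntegral_comp_comm ((hSc x).intervalIntegrable _ _)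
    -- Parseval reduces the weak identity to l ∫₀ᵗ exp(-l s) ds = 1 - exp(-l t) in each coordinate.
    rw [hint, eq_sub_iff_add_eq, ← eq_sub_iff_add_eq', ← inner_sub_right,
      ← e.tsum_inner_mul_inner, ← e.tsum_inner_mul_inner]
    congr 1
    ext1 i
    have h1 : inner 𝕜 (e i) (∫ s in (0 : ℝ)..t, S s x) =
        ∫ s in (0 : ℝ)..t, inner 𝕜 (e i) (S s x) :=
      ((innerSL 𝕜 (e i)).intervalIntegral_comp_comm ((hSc x).intervalIntegrable _ _)).symm
    have h2 : ∫ s in (0 : ℝ)..t, inner 𝕜 (e i) (S s x) =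
        ((∫ s in (0 : ℝ)..t, Real.exp (-l i * s) : ℝ) : 𝕜) * inner 𝕜 (e i) x := by
      rw [← RCLike.intervalIntegral_ofReal, ← intervalIntegral.integral_mul_const]
      refine intervalIntegral.integral_congr fun s hs => ?_
      rw [uIcc_of_le ht] at hs
      exact hS0 s hs.1 x i
    have h3 : l i * ∫ s in (0 : ℝ)..t, Real.exp (-l i * s) = 1 - Real.exp (-l i * t) := by
      have hd : ∀ s ∈ uIcc 0 t, HasDerivAt (fun s => -Real.exp (-l i * s))
          (l i * Real.exp (-l i * s)) s := fun s _ => by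
        have := (((hasDerivAt_id s).const_mul (-l i)).exp).neg
        exact this.congr_deriv (by simp; ring)
      rw [← intervalIntegral.integral_const_mul,
        intervalIntegral.integral_eq_sub_of_hasDerivAt hd (Continuous.intervalIntegrable
          (by fun_prop) _ _)]
      simp
      ring
    rw [hadj, h1, h2, inner_sub_right, hS0 t ht]
    have h4 : (l i : 𝕜) * ((∫ s in (0 : ℝ)..t, Real.exp (-l i * s) : ℝ) : 𝕜) =
        1 - ((Real.exp (-l i * t) : ℝ) : 𝕜) := by exact_mod_cast congrArg (fun r : ℝ => (r : 𝕜)) h3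
    linear_combination (inner 𝕜 (z : H) (e i) * inner 𝕜 (e i) x) * h4
  · intro T d hd h t ht
    refine e.ext_inner fun i => ?_
    rw [inner_zero_right]
    refine eq_zero_of_eq_intervalIntegral (N := fun c : 𝕜 => -(l i : 𝕜) * c) (by fun_prop)
      (K := ‖-(l i : 𝕜)‖) (fun c => (norm_mul _ _).le) (T := T)
      (v := fun t => inner 𝕜 (e i) (d t)) (continuousOn_const.inner hd) (fun s hs => ?_) t ht
    have h1 := h ⟨e i, hedom i⟩ s hs
    simp only [hAadj, inner_smul_left, RCLike.conj_ofReal] at h1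
    rw [h1, ← intervalIntegral.integral_neg]
    simp only [neg_mul]
  · intro z t ht
    simp only [e.adjoint_apply_eq (hS _)]
    exact e.analyticAt_diagonal_exp hl hS0 z ht

end Diagonal

/-! ### Assembling the theorem -/

section Main

variable {𝕜 H U E : Type*} [RCLike 𝕜] [NormedAddCommGroup H] [InnerProductSpace 𝕜 H]
  [CompleteSpace H] [NormedAddCommGroup U] [InnerProductSpace 𝕜 U]
  [NormedAddCommGroup E] [InnerProductSpace 𝕜 E]

theorem NullControllable.of_comp {A : H →ₗ.[𝕜] H} {B : U →L[𝕜] H} (h : NullControllable A B)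
    {K : E →L[𝕜] H} (L : U →L[𝕜] E) (hK : ∀ v, K (L v) = B v) : NullControllable A K := by
  intro T hT
  obtain ⟨C, hC⟩ := h T hT
  refine ⟨‖L‖ * C, fun y₀ => ?_⟩
  obtain ⟨u, hu, hy, hun⟩ := hC y₀
  have hLu : MemLp (fun t => L (u t)) 2 (volume.restrict (Ioo 0 T)) := L.comp_memLp' hu
  refine ⟨_, hLu, by simpa only [hK] using hy, ?_⟩
  rw [← Lp.norm_toLp _ hLu, mul_assoc]
  refine le_trans ?_ (mul_le_mul_of_nonneg_left hun (norm_nonneg L))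
  rw [← Lp.norm_toLp _ hu]
  refine Lp.norm_le_mul_norm_of_ae_le_mul ?_
  filter_upwards [hLu.coeFn_toLp, hu.coeFn_toLp] with t h1 h2
  rw [h1, h2]
  exact L.le_opNorm _

theorem exists_isAnalyticSemigroup [NormedSpace ℝ H] [IsScalarTower ℝ 𝕜 H] {A : H →ₗ.[𝕜] H}
    (hA : (IsSelfAdjoint A ∧ IsPosDef A ∧ HasCompactResolvent A) ∨
      (FiniteDimensional 𝕜 H ∧ A.domain = ⊤)) : ∃ S : ℝ → H →L[𝕜] H, IsAnalyticSemigroup A S := by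
  rcases hA with ⟨hsa, hpos, hres⟩ | ⟨hfin, htop⟩
  · have hsymm : A.IsFormalAdjoint A := by
      have h := A.adjoint_isFormalAdjoint hsa.dense_domain
      rwa [LinearPMap.isSelfAdjoint_def.1 hsa] at h
    obtain ⟨ι, e, l, hl, he⟩ := exists_hilbertBasis_of_hasCompactResolvent hsymm hpos hres
    exact exists_isAnalyticSemigroup_of_hilbertBasis hsa.dense_domain hsymm e hl he
  · exact exists_isAnalyticSemigroup_of_finiteDimensional A htop

end Main

theorem theorem1p1 {𝕜 H U U₁ U₂ : Type*} [RCLike 𝕜]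
    [NormedAddCommGroup H] [InnerProductSpace 𝕜 H] [CompleteSpace H]
    [NormedAddCommGroup U] [InnerProductSpace 𝕜 U] [CompleteSpace U]
    [NormedAddCommGroup U₁] [InnerProductSpace 𝕜 U₁] [CompleteSpace U₁]
    [NormedAddCommGroup U₂] [InnerProductSpace 𝕜 U₂] [CompleteSpace U₂]
    (A : H →ₗ.[𝕜] H)
    (hA : (IsSelfAdjoint A ∧ IsPosDef A ∧ HasCompactResolvent A) ∨
      (FiniteDimensional 𝕜 H ∧ A.domain = ⊤))
    (B : U →L[𝕜] H) (π : (U₁ × U₂) ≃L[𝕜] U) (B₁ : U₁ →L[𝕜] H) (B₂ : U₂ →L[𝕜] H)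
    (hB : ∀ (v₁ : U₁) (v₂ : U₂), B (π (v₁, v₂)) = B₁ v₁ + B₂ v₂)
    (hnull : NullControllable A B) :
    ∀ T : ℝ, 0 < T → ∃ C : ℝ, ∀ y₀ : H, ∃ (u₁ : ℝ → U₁) (u₂ : ℝ → U₂),
      MemLp u₁ 2 (volume.restrict (Ioo 0 T)) ∧
      MemLp u₂ 2 (volume.restrict (Ioo 0 T)) ∧
      (∃ y : ℝ → H, IsSolution A (fun t => B₁ (u₁ t) + B₂ (u₂ t)) T y₀ y ∧ y T = 0) ∧
      (∀ᵐ t ∂(volume.restrict (Ioo 0 T)), ‖u₁ t‖ * ‖u₂ t‖ = 0) ∧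
      (eLpNorm u₁ 2 (volume.restrict (Ioo 0 T))).toReal +
        (eLpNorm u₂ 2 (volume.restrict (Ioo 0 T))).toReal ≤ C * ‖y₀‖ := by
  intro T hT
  let _ : NormedSpace ℝ H := NormedSpace.restrictScalars ℝ 𝕜 H
  have : IsScalarTower ℝ 𝕜 H := ⟨fun r c x => by
    rw [RCLike.real_smul_eq_coe_mul, mul_smul]; rfl⟩
  obtain ⟨S, hS⟩ := exists_isAnalyticSemigroup hA
  set K : WithLp 2 (U₁ × U₂) →L[𝕜] H :=
    B₁.comp (WithLp.fstL 2 𝕜 U₁ U₂) + B₂.comp (WithLp.sndL 2 𝕜 U₁ U₂)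
  -- Boundedness of π⁻¹ is all that is needed to carry controls into the Euclidean product; π need
  -- not be isometric.
  have hK : NullControllable A K := hnull.of_comp
    (((WithLp.prodContinuousLinearEquiv 2 𝕜 U₁ U₂).symm : U₁ × U₂ →L[𝕜] _).comp
      (π.symm : U →L[𝕜] U₁ × U₂)) fun v => by
    conv_rhs => rw [← π.apply_symm_apply v]
    exact (hB _ _).symm
  obtain ⟨C, hC⟩ := hS.exists_switching_control K hK hT
  -- Each component is bounded by the norm of the pair.
  refine ⟨C + C, fun y₀ => ?_⟩
  obtain ⟨u, hu, hy, hsw, hun⟩ := hC y₀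
  have hu₁ : MemLp (fun t => (u t).fst) 2 (volume.restrict (Ioo 0 T)) :=
    (WithLp.fstL 2 𝕜 U₁ U₂).comp_memLp' hu
  have hu₂ : MemLp (fun t => (u t).snd) 2 (volume.restrict (Ioo 0 T)) :=
    (WithLp.sndL 2 𝕜 U₁ U₂).comp_memLp' hu
  refine ⟨_, _, hu₁, hu₂, hy, ?_, ?_⟩
  · filter_upwards [hsw] with t ht
    rcases ht with h | h <;> simp [h]
  · have h1 : (eLpNorm (fun t => (u t).fst) 2 (volume.restrict (Ioo 0 T))).toReal ≤
        (eLpNorm u 2 (volume.restrict (Ioo 0 T))).toReal :=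
      ENNReal.toReal_mono hu.2.ne (eLpNorm_mono fun t => WithLp.norm_fst_le _ _)
    have h2 : (eLpNorm (fun t => (u t).snd) 2 (volume.restrict (Ioo 0 T))).toReal ≤
        (eLpNorm u 2 (volume.restrict (Ioo 0 T))).toReal :=
      ENNReal.toReal_mono hu.2.ne (eLpNorm_mono fun t => WithLp.norm_snd_le _ _)
    linarith
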